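/- Throughout, $X$ is a real Banach space with a (Schauder) basis $(e_i)_{i\ge 1}$ and $\mathbb N=\{1,2,\dots\}$. **Definitions.** For finite $F,G\subseteq\mathbb N$, $F<G$ means $\max F<\min G$. For families $\mathcal F,\mathcal G$ of finite subsets of $\mathbb N$ put $\mathcal F[\mathcal G]=\{\bigcup_{i=1}^n G_i : G_1<\dots<G_n \text{ nonempty},\ G_i\in\mathcal G,\ \{\min G_i\}_{i=1}^n\in\mathcal F\}$ (with $n=0$ allowed, giving $\emptyset$, if $\emptyset\in\mathcal F$). The Schreier families $\mathcal S_\alpha$, $\alpha<\omega_1$, are $\mathcal S_0=\{\emptyset\}\cup\{\{n\}:n\in\mathbb N\}$, $\mathcal S_{\alpha+1}=\mathcal S_1[\mathcal S_\alpha]$ with $\mathcal S_1=\{\emptyset\}\cup\{F:|F|\le\min F\}$, and, for a limit ordinal $\alpha$, $\mathcal S_\alpha=\{F:\ F\in\mathcal S_{\alpha_n}\text{ and } n\le \min F \text{ for some } n\in\mathbb N\}\cup\{\emptyset\}$, where $(\alpha_n)_{n\ge1}$ is a chosen nondecreasing sequence of ordinals $\alpha_n<\alpha$ with supremum $\alpha$.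 The choice of these sequences is arbitrary but fixed. For a basic sequence $(x_i)$, a finite or infinite sequence of nonzero finite linear combinations $y_j$ of the $x_i$ with $\operatorname{supp}y_1<\operatorname{supp}y_2<\cdots$ (supports with respect to $(x_i)$) is called a block sequence of $(x_i)$; we write $(y_j)\prec(x_i)$ and, if it is infinite, call it a block basis. A finite one $(y_j)_{j=1}^k$ is $\mathcal F$-admissible if $\{\min\operatorname{supp}y_j\}_{j=1}^k\in\mathcal F$. For a norm $|\cdot|$, let $\delta_\alpha((x_i),|\cdot|)$ be the supremum of all $\delta\ge 0$ such that $|\sum_{j=1}^k y_j|\ge\delta\sum_{j=1}^k|y_j|$ for every $\mathcal S_\alpha$-admissible $(y_j)_{j=1}^k\prec(x_i)$; write $\delta_\alpha(x_i)$ for the given norm. Put $\dot\delta_\alpha((x_i),|\cdot|)=\sup\{\delta_\alpha((y_i),|\cdot|):(y_i)\prec(x_i)\text{ a block basis}\}$ and $\ddot\delta_\alpha(X)=\sup\{\dot\delta_\alpha((e_i),|\cdot|):|\cdot|\text{ an equivalent norm on }X\}$. A basic sequence $(x_i)$ *$\Delta$-stabilizes* $\gamma=(\gamma_\alpha)_{\alpha<\omega_1}\subseteq\mathbb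 R$ under $|\cdot|$ if there are $\varepsilon_n\downarrow0$ such that for every $\alpha<\omega_1$ there is $m$ such that for all $n\ge m$ and all block bases $(y_i)\prec(x_i)_{i\ge n}$, $|\delta_\alpha((y_i),|\cdot|)-\gamma_\alpha|<\varepsilon_n$. The *$\Delta$-spectrum* $\Delta(X)$ is the set of all $\gamma$ that are $\Delta$-stabilized, under the norm of $X$, by some block basis $(x_i)\prec(e_i)$; $\ddot\Delta(X)$ is the set of all $\gamma$ that are $\Delta$-stabilized by some block basis $(x_i)\prec(e_i)$ under some equivalent norm on the closed linear span $[x_i]_{i\in\mathbb N}$. **Proposition.** Let $X$ be a real Banach space with a basis $(e_i)$. a) $\Delta(X)\neq\emptyset$, and if $\gamma\in\Delta(X)$ then $\gamma_\alpha\in[0,1]$ for all $\alpha<\omega_1$. b) $X$ contains a subspace isomorphic to $\ell_1$ if and only if there is $\gamma\in\Delta(X)$ with $\gamma_1=1$. c) If $\gamma\in\Delta(X)$ and $\alpha\le\beta<\omega_1$, then $\gamma_\alpha\ge\gamma_\beta$. d) If $\gamma\in\Delta(X)$ and $\alpha,\beta<\omega_1$, then $\gamma_\alpha\gamma_\beta\le\gamma_{\beta+\alpha}$.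 e) If $\gamma\in\Delta(X)$, $\alpha<\omega_1$ and $n\in\mathbb N$, then $\gamma_{\alpha\cdot n}\ge(\gamma_\alpha)^n$. f) If $\gamma\in\Delta(X)$, then $\alpha\mapsto\gamma_\alpha$ is continuous on $[0,\omega_1)$ with the order topology. g) For every $\alpha<\omega_1$, $\ddot\delta_\alpha(X)=\sup\{\gamma_\alpha:\gamma\in\ddot\Delta(X)\}$. -/

import Mathlib

open Set Filter Topology Ordinal

/-! Conventions. Sequences and sets of positive integers are indexed from `0`, as is usual in Lean:
the Lean index `i : ℕ` stands for the positive integer `i + 1`. So the `i`-th vector of a sequence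
`x : ℕ → E` is `x i` where one usually writes `x_{i+1}`, and a finite set of positive integers `F`
is represented by `{i | i + 1 ∈ F}`. -/

namespace DeltaSpectrum

/-! ### Countable ordinals -/

/-- The set of ordinals `α < ω₁`. -/
abbrev CountableOrdinal : Type 1 := Set.Iio (ω₁ : Ordinal.{0})

theorem one_lt_omega_one : (1 : Ordinal.{0}) < ω₁ :=
  one_lt_omega0.trans omega0_lt_omega_one

theorem add_lt_omega_one {α β : Ordinal.{0}} (hα : α < ω₁) (hβ : β < ω₁) : α + β < ω₁ :=
  isPrincipal_add_omega 1 hα hβ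

theorem mul_nat_lt_omega_one {α : Ordinal.{0}} (hα : α < ω₁) (n : ℕ) : α * n < ω₁ := by
  induction n with
  | zero => simpa using omega_pos 1
  | succ n ih =>
    rw [Nat.cast_succ, mul_add, mul_one]
    exact add_lt_omega_one ih hα

/-! ### Schreier families -/

/-- The `ℱ[𝒢]` operation: unions of `G_1 < ⋯ < G_n` with `G_i ∈ 𝒢` (nonempty) and
`{min G_1, …, min G_n} ∈ ℱ`. -/
def familyComp (ℱ 𝒢 : Set (Finset ℕ)) : Set (Finset ℕ) :=
  {H | ∃ (n : ℕ) (G : Fin n → Finset ℕ) (hne : ∀ i, (G i).Nonempty),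
    (∀ i, G i ∈ 𝒢) ∧
    (∀ i j, i < j → ∀ a ∈ G i, ∀ b ∈ G j, a < b) ∧
    Finset.univ.image (fun i => (G i).min' (hne i)) ∈ ℱ ∧
    H = Finset.univ.biUnion G}

/-- `𝒮₀`: the empty set and the singletons. -/
def schreierZero : Set (Finset ℕ) := {F | F.card ≤ 1}

/-- `𝒮₁`: the sets with `|F| ≤ min F`, and the empty set (`i` stands for the integer `i + 1`). -/
def schreierOne : Set (Finset ℕ) := {F | ∀ i ∈ F, F.card ≤ i + 1}

/-- A choice, for every limit ordinal `α < ω₁`, of ordinals `α_1 ≤ α_2 ≤ ⋯ < α` with supremum `α`;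
`seq α n` is `α_{n+1}`. -/
structure LimitSequences where
  seq : Ordinal.{0} → ℕ → Ordinal.{0}
  monotone : ∀ α, Order.IsSuccLimit α → α < ω₁ → Monotone (seq α)
  lt : ∀ α, Order.IsSuccLimit α → α < ω₁ → ∀ n, seq α n < α
  cofinal : ∀ α, Order.IsSuccLimit α → α < ω₁ → ∀ β < α, ∃ n, β < seq α n

/-- The Schreier families `𝒮_α` determined by a choice of sequences at limit ordinals:
`𝒮_{α+1} = 𝒮₁[𝒮_α]`, and for a limit `α`, `F ∈ 𝒮_α` iff for some `n`, `F ∈ 𝒮_{α_n}` and `n ≤ F`.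
(Only `α < ω₁` matters; there `A.seq α n < α` holds automatically.) -/
noncomputable def schreier (A : LimitSequences) (α : Ordinal.{0}) : Set (Finset ℕ) :=
  Ordinal.limitRecOn (motive := fun _ => Set (Finset ℕ)) α
    schreierZero
    (fun _ S => familyComp schreierOne S)
    (fun α _ S => {F | ∃ (n : ℕ) (h : A.seq α n < α), F ∈ S (A.seq α n) h ∧ ∀ i ∈ F, n ≤ i})

theorem schreier_zero (A : LimitSequences) : schreier A 0 = schreierZero := by
  simp [schreier]

theorem schreier_add_one (A : LimitSequences) (α : Ordinal.{0}) :
    schreier A (α + 1) = familyComp schreierOne (schreier A α) := by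
  simp [schreier]

theorem schreier_limit (A : LimitSequences) {α : Ordinal.{0}} (hα : Order.IsSuccLimit α)
    (h1 : α < ω₁) :
    schreier A α = {F | ∃ n : ℕ, F ∈ schreier A (A.seq α n) ∧ ∀ i ∈ F, n ≤ i} := by
  ext F
  unfold schreier
  rw [Ordinal.limitRecOn_limit (h := hα)]
  exact ⟨fun ⟨n, _, h⟩ => ⟨n, h⟩, fun ⟨n, h⟩ => ⟨n, A.lt α hα h1 n, h⟩⟩

/-! ### Blocks and block bases -/

/-- A (finite or infinite) family of nonzero finitely supported coefficient sequences with
successive supports. -/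
def IsBlock {ι : Type*} [LT ι] (c : ι → ℕ →₀ ℝ) : Prop :=
  (∀ i, c i ≠ 0) ∧ ∀ i j, i < j → ∀ a ∈ (c i).support, ∀ b ∈ (c j).support, a < b

section
variable {E : Type*} [NormedAddCommGroup E] [NormedSpace ℝ E]

/-- `(y_i) ≺ (x_i)`: the sequence `y` is a block basis of the (basic) sequence `x`. -/
def IsBlockBasis (x y : ℕ → E) : Prop :=
  ∃ c : ℕ → ℕ →₀ ℝ, IsBlock c ∧ ∀ i, y i = Finsupp.linearCombination ℝ x (c i)

/-- A finite block family `(c_1, …, c_k)` is `ℱ`-admissible if `{min supp c_i : i ≤ k} ∈ ℱ`. -/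
def IsAdmissible (ℱ : Set (Finset ℕ)) {k : ℕ} (c : Fin k → ℕ →₀ ℝ) : Prop :=
  ∃ h : IsBlock c, Finset.univ.image
    (fun i => (c i).support.min' (Finsupp.support_nonempty_iff.2 (h.1 i))) ∈ ℱ

/-- `|·|` is an equivalent norm on `E`. -/
def IsEquivalentNorm (p : Seminorm ℝ E) : Prop :=
  ∃ a b : ℝ, 0 < a ∧ 0 < b ∧ ∀ v, a * ‖v‖ ≤ p v ∧ p v ≤ b * ‖v‖

/-! ### Asymptotic constants -/

/-- `δ_ℱ((x_i), |·|)`: the supremum of the `δ ≥ 0` with `|∑ y_i| ≥ δ ∑ |y_i|` for all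
`ℱ`-admissible blocks `y_1 < ⋯ < y_k` of `(x_i)`. -/
noncomputable def delta (ℱ : Set (Finset ℕ)) (p : Seminorm ℝ E) (x : ℕ → E) : ℝ :=
  sSup {δ : ℝ | 0 ≤ δ ∧ ∀ (k : ℕ) (c : Fin k → ℕ →₀ ℝ), IsAdmissible ℱ c →
    δ * ∑ i, p (Finsupp.linearCombination ℝ x (c i)) ≤
      p (∑ i, Finsupp.linearCombination ℝ x (c i))}

/-- `δ̇_ℱ((x_i), |·|)`: the supremum of `δ_ℱ((y_i), |·|)` over all `(y_i) ≺ (x_i)`. -/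
noncomputable def deltaDot (ℱ : Set (Finset ℕ)) (p : Seminorm ℝ E) (x : ℕ → E) : ℝ :=
  sSup {d : ℝ | ∃ y, IsBlockBasis x y ∧ d = delta ℱ p y}

/-- `δ̈_ℱ(x_i)`: the supremum of `δ̇_ℱ((x_i), |·|)` over all equivalent norms `|·|` on `E`
(where `(x_i)` is a basis of `E`). -/
noncomputable def deltaDDot (ℱ : Set (Finset ℕ)) (x : ℕ → E) : ℝ :=
  sSup {d : ℝ | ∃ p : Seminorm ℝ E, IsEquivalentNorm p ∧ d = deltaDot ℱ p x}

/-! ### The spectrum -/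

/-- The sequence `(x_i)` `Δ`-stabilizes `γ = (γ_α)_{α < ω₁}` under the norm `|·|`. -/
def Stabilizes (A : LimitSequences) (p : Seminorm ℝ E) (x : ℕ → E)
    (γ : CountableOrdinal → ℝ) : Prop :=
  ∃ ε : ℕ → ℝ, Antitone ε ∧ Tendsto ε atTop (𝓝 0) ∧
    ∀ α : CountableOrdinal, ∃ m : ℕ, ∀ n ≥ m, ∀ y : ℕ → E,
      IsBlockBasis (fun i => x (n + i)) y →
        |delta (schreier A α) p y - γ α| < ε n

/-- The `Δ`-spectrum `Δ(E)` of a space `E` with basis `(e_i)`. -/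
def spectrum (A : LimitSequences) (e : ℕ → E) : Set (CountableOrdinal → ℝ) :=
  {γ | ∃ x, IsBlockBasis e x ∧ Stabilizes A (normSeminorm ℝ E) x γ}

/-- The closed linear span `[x_i]`. -/
def closedSpan (x : ℕ → E) : Submodule ℝ E :=
  (Submodule.span ℝ (Set.range x)).topologicalClosure

/-- The sequence `(x_i)` as a sequence in its closed linear span `[x_i]`. -/
def toClosedSpan (x : ℕ → E) (i : ℕ) : closedSpan x :=
  ⟨x i, Submodule.le_topologicalClosure _ (Submodule.subset_span ⟨i, rfl⟩)⟩

/-- `Δ̈(E)`: the families stabilized by some `(x_i) ≺ (e_i)` under some equivalent norm on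
`[x_i]`. -/
def spectrumDDot (A : LimitSequences) (e : ℕ → E) : Set (CountableOrdinal → ℝ) :=
  {γ | ∃ x, IsBlockBasis e x ∧ ∃ p : Seminorm ℝ (closedSpan x),
    IsEquivalentNorm p ∧ Stabilizes A p (toClosedSpan x) γ}

variable (E) in
/-- `E` contains `ℓ₁`: some subspace of `E` is isomorphic to `ℓ₁`. -/
def ContainsEllOne : Prop :=
  ∃ Y : Submodule ℝ E, Nonempty (lp (fun _ : ℕ => ℝ) 1 ≃L[ℝ] Y)

end

end DeltaSpectrum

/-! Everything rests on two monotonicity facts: passing to a block basis moves minima of supports to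
the right, so it can only increase `delta` of a spreading family, and it can only decrease
`deltaDot`.

Existence of a stabilized family. For a fixed rational `q`, the least `α` with `deltaDot` below `q`
is an ordinal that decreases under block bases, so some block basis minimizes it. Diagonalizing over
`q` gives a block basis on which all `deltaDot` are hereditarily constant (`exists_deltaDot_eq`). If
one of these constants vanishes at some `β < ω₁`, only the countably many `α ≤ β` matter, and a
second diagonalization makes `delta` of the tails approach `deltaDot`. If none vanishes, the
uncountable cofinality of `ω₁` bounds them below by one `c > 0`. The tree of finite rational block
sequences with a lower `ℓ₁` estimate then has nodes of every countable rank. Since it is a countable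
tree, it has an infinite branch, that is, a block basis equivalent to the `ℓ₁` basis; James's
argument improves the constant towards `1`, and the constant family `1` is stabilized.

The link with `ℓ₁`: a copy of `ℓ₁` gives a block basis with an `ℓ₁` estimate by a gliding hump, and
James applies again. Conversely, `γ₁ = 1` lets vectors be split off one at a time with losses
`2^{-(i+2)}`, which are summable.

The algebraic properties come from the combinatorics of the families. For `α ≤ β`, sets of `𝒮_α` far
to the right lie in `𝒮_β` (monotonicity); sets of `𝒮_{β+α}`, spread out enough, lie in `𝒮_α[𝒮_β]`,
and lower estimates multiply under this operation (product law, hence powers). Continuity at a limit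
uses one sparse subsequence serving all `α_n` at once.

For the supremum formula, an equivalent norm on a closed span extends to the whole space, and
stabilizing a block basis does not lower its constants. -/

namespace DeltaSpectrum

/-! ### Combinatorics of the Schreier families -/

/-- The part of `H` from `m` up to the next element of `M`. -/
def segment (M H : Finset ℕ) (m : ℕ) : Finset ℕ :=
  H.filter fun a => m ≤ a ∧ ∀ m' ∈ M, m < m' → a < m'

theorem mem_segment {M H : Finset ℕ} {m a : ℕ} :
    a ∈ segment M H m ↔ a ∈ H ∧ m ≤ a ∧ ∀ m' ∈ M, m < m' → a < m' := by
  simp [segment]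

theorem exists_mem_segment {M H : Finset ℕ} {a : ℕ} (ha : a ∈ H) (h : ∃ m ∈ M, m ≤ a) :
    ∃ m ∈ M, a ∈ segment M H m := by
  obtain ⟨m, hm, hma⟩ := h
  have hne : (M.filter (· ≤ a)).Nonempty := ⟨m, by simp [hm, hma]⟩
  have h1 := Finset.max'_mem _ hne
  rw [Finset.mem_filter] at h1
  refine ⟨_, h1.1, mem_segment.2 ⟨ha, h1.2, fun m' hm' hlt => ?_⟩⟩
  by_contra hcon
  exact absurd (Finset.le_max' (M.filter (· ≤ a)) m' (by simp [hm']; omega)) (by omega)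

theorem eq_of_mem_segment {M H H' : Finset ℕ} {m m' a : ℕ} (hm : m ∈ M) (hm' : m' ∈ M)
    (h : a ∈ segment M H m) (h' : a ∈ segment M H' m') : m = m' := by
  rw [mem_segment] at h h'
  rcases lt_trichotomy m m' with hlt | heq | hlt
  · have := h.2.2 m' hm' hlt; omega
  · exact heq
  · have := h'.2.2 m hm hlt; omega

/-- Membership in `ℱ[𝒢]` in terms of the set `M` of minima of the pieces. -/
theorem mem_familyComp_iff {ℱ 𝒢 : Set (Finset ℕ)} {H : Finset ℕ} :
    H ∈ familyComp ℱ 𝒢 ↔ ∃ M ∈ ℱ, M ⊆ H ∧ (∀ a ∈ H, ∃ m ∈ M, m ≤ a) ∧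
      ∀ m ∈ M, segment M H m ∈ 𝒢 := by
  constructor
  · rintro ⟨n, G, hne, hG, hlt, hM, rfl⟩
    have hmin : ∀ i, (G i).min' (hne i) ∈ G i := fun i => Finset.min'_mem _ _
    have hle : ∀ i, ∀ a ∈ G i, (G i).min' (hne i) ≤ a := fun i a ha => Finset.min'_le _ _ ha
    refine ⟨_, hM, ?_, ?_, ?_⟩
    · intro m hm
      obtain ⟨i, -, rfl⟩ := Finset.mem_image.1 hm
      exact Finset.mem_biUnion.2 ⟨i, Finset.mem_univ _, hmin i⟩
    · intro a ha
      obtain ⟨i, -, hi⟩ := Finset.mem_biUnion.1 ha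
      exact ⟨_, Finset.mem_image.2 ⟨i, Finset.mem_univ _, rfl⟩, hle i a hi⟩
    · intro m hm
      obtain ⟨i, -, rfl⟩ := Finset.mem_image.1 hm
      convert hG i using 1
      ext a
      rw [mem_segment]
      constructor
      · rintro ⟨ha, h1, h2⟩
        obtain ⟨j, -, hj⟩ := Finset.mem_biUnion.1 ha
        rcases lt_trichotomy i j with hij | rfl | hij
        · have h3 := h2 _ (Finset.mem_image.2 ⟨j, Finset.mem_univ _, rfl⟩)
            (hlt i j hij _ (hmin i) _ (hmin j))
          have := hle j a hj
          omega
        · exact hj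
        · have := hlt j i hij a hj _ (hmin i)
          omega
      · intro ha
        refine ⟨Finset.mem_biUnion.2 ⟨i, Finset.mem_univ _, ha⟩, hle i a ha, ?_⟩
        intro m' hm' hlt'
        obtain ⟨j, -, rfl⟩ := Finset.mem_image.1 hm'
        rcases lt_trichotomy i j with hij | rfl | hij
        · exact hlt i j hij a ha _ (hmin j)
        · omega
        · have := hlt j i hij _ (hmin j) _ (hmin i)
          omega
  · rintro ⟨M, hM, hMH, hH, hseg⟩
    -- The pieces are the segments of `H` cut off by `M`, listed in increasing order.
    let o := M.orderEmbOfFin rfl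
    have ho : ∀ i, o i ∈ M := fun i => M.orderEmbOfFin_mem rfl i
    have hmem : ∀ i, o i ∈ segment M H (o i) := fun i =>
      mem_segment.2 ⟨hMH (ho i), le_rfl, fun m' _ h => h⟩
    have hmin : ∀ i, (segment M H (o i)).min' ⟨_, hmem i⟩ = o i := fun i =>
      le_antisymm (Finset.min'_le _ _ (hmem i))
        (Finset.le_min' _ _ _ fun a ha => (mem_segment.1 ha).2.1)
    refine ⟨M.card, fun i => segment M H (o i), fun i => ⟨_, hmem i⟩, fun i => hseg _ (ho i),
      ?_, ?_, ?_⟩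
    · intro i j hij a ha b hb
      have h1 := (mem_segment.1 ha).2.2 (o j) (ho j) (o.strictMono hij)
      have h2 := (mem_segment.1 hb).2.1
      omega
    · simp only [hmin]
      convert hM
      ext m
      simp only [Finset.mem_image, Finset.mem_univ, true_and]
      rw [← Finset.mem_coe, ← Finset.range_orderEmbOfFin M rfl]
      rfl
    · ext a
      simp only [Finset.mem_biUnion, Finset.mem_univ, true_and]
      constructor
      · intro ha
        obtain ⟨m, hm, h⟩ := exists_mem_segment ha (hH a ha)
        rw [← Finset.mem_coe, ← Finset.range_orderEmbOfFin M rfl] at hm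
        obtain ⟨i, rfl⟩ := hm
        exact ⟨i, h⟩
      · rintro ⟨i, hi⟩
        exact (mem_segment.1 hi).1

/-- The family `ℱ` is closed under moving the elements of its members to the right. -/
def IsSpreading (ℱ : Set (Finset ℕ)) : Prop :=
  ∀ F ∈ ℱ, ∀ φ : ℕ → ℕ, StrictMonoOn φ F → (∀ i ∈ F, i ≤ φ i) → F.image φ ∈ ℱ

theorem segment_image {M H : Finset ℕ} {φ : ℕ → ℕ} (hφ : StrictMonoOn φ H) (hMH : M ⊆ H) {m : ℕ}
    (hm : m ∈ M) : segment (M.image φ) (H.image φ) (φ m) = (segment M H m).image φ := by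
  ext a
  simp only [mem_segment, Finset.mem_image]
  constructor
  · rintro ⟨⟨b, hb, rfl⟩, h1, h2⟩
    refine ⟨b, ⟨hb, (hφ.le_iff_le (hMH hm) hb).1 h1, fun m' hm' hlt => ?_⟩, rfl⟩
    exact (hφ.lt_iff_lt hb (hMH hm')).1
      (h2 _ ⟨m', hm', rfl⟩ (hφ (hMH hm) (hMH hm') hlt))
  · rintro ⟨b, ⟨hb, h1, h2⟩, rfl⟩
    refine ⟨⟨b, hb, rfl⟩, (hφ.le_iff_le (hMH hm) hb).2 h1, ?_⟩
    rintro _ ⟨m', hm', rfl⟩ hlt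
    exact hφ hb (hMH hm') (h2 m' hm' ((hφ.lt_iff_lt (hMH hm) (hMH hm')).1 hlt))

/-- The source and target families may differ and only subsets of `H` are tested: this serves both
for spreading and for the induction that embeds `𝒮_{β+α}` into `𝒮_α[𝒮_β]`. -/
theorem image_mem_familyComp {ℱ 𝒢 ℱ' 𝒢' : Set (Finset ℕ)} {φ : ℕ → ℕ} {H : Finset ℕ}
    (hφ : StrictMonoOn φ H)
    (h1 : ∀ F ∈ ℱ, F ⊆ H → F.image φ ∈ ℱ') (h2 : ∀ G ∈ 𝒢, G ⊆ H → G.image φ ∈ 𝒢')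
    (hH : H ∈ familyComp ℱ 𝒢) : H.image φ ∈ familyComp ℱ' 𝒢' := by
  obtain ⟨M, hM, hMH, hle, hseg⟩ := mem_familyComp_iff.1 hH
  refine mem_familyComp_iff.2 ⟨M.image φ, h1 M hM hMH, Finset.image_subset_image hMH, ?_, ?_⟩
  · intro a ha
    obtain ⟨b, hb, rfl⟩ := Finset.mem_image.1 ha
    obtain ⟨m, hm, hmb⟩ := hle b hb
    exact ⟨φ m, Finset.mem_image_of_mem _ hm, (hφ.le_iff_le (hMH hm) hb).2 hmb⟩
  · intro a ha
    obtain ⟨m, hm, rfl⟩ := Finset.mem_image.1 ha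
    rw [segment_image hφ hMH hm]
    exact h2 _ (hseg m hm) (Finset.filter_subset _ _)

theorem familyComp_spreading {ℱ 𝒢 : Set (Finset ℕ)} (hℱ : IsSpreading ℱ) (h𝒢 : IsSpreading 𝒢) :
    IsSpreading (familyComp ℱ 𝒢) := fun H hH φ hφ hle =>
  image_mem_familyComp hφ
    (fun F hF hFH => hℱ F hF φ (hφ.mono (by exact_mod_cast hFH)) fun i hi => hle i (hFH hi))
    (fun F hF hFH => h𝒢 F hF φ (hφ.mono (by exact_mod_cast hFH)) fun i hi => hle i (hFH hi)) hH

theorem schreierOne_spreading : IsSpreading schreierOne := by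
  intro F hF φ _ hle i hi
  obtain ⟨j, hj, rfl⟩ := Finset.mem_image.1 hi
  have h1 := hF j hj
  have h2 := hle j hj
  have h3 := Finset.card_image_le (s := F) (f := φ)
  omega

/-- Each segment of `H` over `M` is cut again by its own set `N m` of minima. Since `m` is the least
element of its segment, it belongs to `N m`; hence the union of the `N m` refines the cuts at `M`
and cuts out exactly the small pieces. -/
theorem familyComp_assoc {ℱ 𝒢 ℋ : Set (Finset ℕ)} :
    familyComp ℱ (familyComp 𝒢 ℋ) ⊆ familyComp (familyComp ℱ 𝒢) ℋ := by
  intro H hH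
  obtain ⟨M, hM, hMH, hle, hseg⟩ := mem_familyComp_iff.1 hH
  have hseg' : ∀ m, ∃ N : Finset ℕ, m ∈ M → N ∈ 𝒢 ∧ N ⊆ segment M H m ∧
      (∀ a ∈ segment M H m, ∃ n ∈ N, n ≤ a) ∧ ∀ n ∈ N, segment N (segment M H m) n ∈ ℋ := by
    intro m
    by_cases hm : m ∈ M
    · obtain ⟨N, h1, h2, h3, h4⟩ := mem_familyComp_iff.1 (hseg m hm)
      exact ⟨N, fun _ => ⟨h1, h2, h3, h4⟩⟩
    · exact ⟨∅, fun h => absurd h hm⟩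
  choose N hN using hseg'
  have hNsub : ∀ m ∈ M, ∀ n ∈ N m, n ∈ segment M H m := fun m hm n hn => (hN m hm).2.1 hn
  have hmN : ∀ m ∈ M, m ∈ N m := by
    intro m hm
    obtain ⟨n, hn, hnm⟩ := (hN m hm).2.2.1 m (mem_segment.2 ⟨hMH hm, le_rfl, fun _ _ h => h⟩)
    have := (mem_segment.1 (hNsub m hm n hn)).2.1
    rwa [le_antisymm hnm this] at hn
  have hseg1 : ∀ m ∈ M, segment M (M.biUnion N) m = N m := by
    intro m hm
    ext a
    constructor
    · intro ha
      obtain ⟨m', hm', ha'⟩ := Finset.mem_biUnion.1 (mem_segment.1 ha).1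
      rwa [eq_of_mem_segment hm hm' ha (hNsub m' hm' a ha')]
    · intro ha
      have := mem_segment.1 (hNsub m hm a ha)
      exact mem_segment.2 ⟨Finset.mem_biUnion.2 ⟨m, hm, ha⟩, this.2⟩
  refine mem_familyComp_iff.2 ⟨M.biUnion N, mem_familyComp_iff.2 ⟨M, hM, ?_, ?_, ?_⟩, ?_, ?_, ?_⟩
  · exact fun m hm => Finset.mem_biUnion.2 ⟨m, hm, hmN m hm⟩
  · intro a ha
    obtain ⟨m, hm, h⟩ := Finset.mem_biUnion.1 ha
    exact ⟨m, hm, (mem_segment.1 (hNsub m hm a h)).2.1⟩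
  · intro m hm
    rw [hseg1 m hm]
    exact (hN m hm).1
  · intro a ha
    obtain ⟨m, hm, h⟩ := Finset.mem_biUnion.1 ha
    exact (mem_segment.1 (hNsub m hm a h)).1
  · intro a ha
    obtain ⟨m, hm, h⟩ := exists_mem_segment ha (hle a ha)
    obtain ⟨n, hn, hna⟩ := (hN m hm).2.2.1 a h
    exact ⟨n, Finset.mem_biUnion.2 ⟨m, hm, hn⟩, hna⟩
  · intro n hn
    obtain ⟨m, hm, h⟩ := Finset.mem_biUnion.1 hn
    convert (hN m hm).2.2.2 n h using 1
    have hn1 := mem_segment.1 (hNsub m hm n h)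
    ext a
    rw [mem_segment, mem_segment, mem_segment]
    constructor
    · rintro ⟨ha, h1, h2⟩
      refine ⟨⟨ha, hn1.2.1.trans h1, fun m' hm' hlt => ?_⟩, h1, fun m' hm' hlt => ?_⟩
      · exact h2 m' (Finset.mem_biUnion.2 ⟨m', hm', hmN m' hm'⟩) (hn1.2.2 m' hm' hlt)
      · exact h2 m' (Finset.mem_biUnion.2 ⟨m, hm, hm'⟩) hlt
    · rintro ⟨⟨ha, h1, h2⟩, h3, h4⟩
      refine ⟨ha, h3, fun n' hn' hlt => ?_⟩
      obtain ⟨m', hm', h'⟩ := Finset.mem_biUnion.1 hn'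
      have hn2 := mem_segment.1 (hNsub m' hm' n' h')
      rcases lt_trichotomy m m' with hmm | rfl | hmm
      · exact (h2 m' hm' hmm).trans_le hn2.2.1
      · exact h4 n' h' hlt
      · have := hn2.2.2 m hm hmm
        omega

variable {A : LimitSequences} {α β : Ordinal.{0}}

theorem empty_mem_familyComp {ℱ 𝒢 : Set (Finset ℕ)} (h : ∅ ∈ ℱ) : ∅ ∈ familyComp ℱ 𝒢 :=
  mem_familyComp_iff.2 ⟨∅, h, by simp, by simp, by simp⟩

theorem mem_familyComp_of_singletons {ℱ 𝒢 : Set (Finset ℕ)} (h0 : ∅ ∈ ℱ) (h1 : ∀ m, {m} ∈ ℱ) :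
    𝒢 ⊆ familyComp ℱ 𝒢 := by
  intro H hH
  rcases H.eq_empty_or_nonempty with rfl | hne
  · exact empty_mem_familyComp h0
  · refine mem_familyComp_iff.2 ⟨{H.min' hne}, h1 _, ?_, ?_, ?_⟩
    · simpa using Finset.min'_mem _ _
    · exact fun a ha => ⟨_, by simp, Finset.min'_le _ _ ha⟩
    · intro m hm
      obtain rfl := Finset.mem_singleton.1 hm
      convert hH
      ext a
      simp only [mem_segment, Finset.mem_singleton, forall_eq]
      exact ⟨fun h => h.1, fun h => ⟨h, Finset.min'_le _ _ h, fun h => absurd h (lt_irrefl _)⟩⟩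

theorem schreierOne_empty : ∅ ∈ schreierOne := by simp [schreierOne]

theorem schreierOne_singleton (m : ℕ) : {m} ∈ schreierOne := by simp [schreierOne]

theorem schreier_subset_add_one : schreier A α ⊆ schreier A (α + 1) := by
  rw [schreier_add_one]
  exact mem_familyComp_of_singletons schreierOne_empty schreierOne_singleton

theorem schreier_card_le_one (hα : α < ω₁) {F : Finset ℕ} (hF : F.card ≤ 1) :
    F ∈ schreier A α := by
  induction α using Ordinal.limitRecOn with
  | zero => rw [schreier_zero]; exact hF
  | add_one α ih => exact schreier_subset_add_one (ih ((lt_add_one α).trans hα))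
  | limit α hlim ih =>
    rw [schreier_limit A hlim hα]
    rcases F.eq_empty_or_nonempty with rfl | ⟨i, hi⟩
    · exact ⟨0, ih _ (A.lt α hlim hα 0) ((A.lt α hlim hα 0).trans hα), by simp⟩
    · exact ⟨0, ih _ (A.lt α hlim hα _) ((A.lt α hlim hα _).trans hα), by simp⟩

theorem schreier_spreading (hα : α < ω₁) : IsSpreading (schreier A α) := by
  induction α using Ordinal.limitRecOn with
  | zero =>
    rw [schreier_zero]
    exact fun F hF φ _ _ => Finset.card_image_le.trans hF
  | add_one α ih =>
    rw [schreier_add_one]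
    exact familyComp_spreading schreierOne_spreading (ih ((lt_add_one α).trans hα))
  | limit α hlim ih =>
    rw [schreier_limit A hlim hα]
    rintro F ⟨n, hF, hn⟩ φ hφ hle
    refine ⟨n, ih _ (A.lt α hlim hα n) ((A.lt α hlim hα n).trans hα) F hF φ hφ hle, ?_⟩
    intro i hi
    obtain ⟨j, hj, rfl⟩ := Finset.mem_image.1 hi
    exact (hn j hj).trans (hle j hj)

/-- The families need not increase with the index, because membership at a limit also asks the set
to start late enough. Each limit stage met in the induction raises the threshold `k`. -/
theorem schreier_eventually_subset (hβ : β < ω₁) (hαβ : α ≤ β) :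
    ∃ k : ℕ, ∀ F ∈ schreier A α, (∀ i ∈ F, k ≤ i) → F ∈ schreier A β := by
  induction β using Ordinal.limitRecOn with
  | zero =>
    obtain rfl := le_zero_iff.1 hαβ
    exact ⟨0, fun F hF _ => hF⟩
  | add_one β ih =>
    rcases hαβ.eq_or_lt with rfl | hlt
    · exact ⟨0, fun F hF _ => hF⟩
    · obtain ⟨k, hk⟩ := ih ((lt_add_one β).trans hβ) (Order.lt_add_one_iff.1 hlt)
      exact ⟨k, fun F hF hi => schreier_subset_add_one (hk F hF hi)⟩
  | limit β hlim ih =>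
    rcases hαβ.eq_or_lt with rfl | hlt
    · exact ⟨0, fun F hF _ => hF⟩
    · obtain ⟨n, hn⟩ := A.cofinal β hlim hβ α hlt
      obtain ⟨k, hk⟩ := ih _ (A.lt β hlim hβ n) ((A.lt β hlim hβ n).trans hβ) hn.le
      refine ⟨max k n, fun F hF hi => ?_⟩
      rw [schreier_limit A hlim hβ]
      exact ⟨n, hk F hF fun i h => (le_max_left _ _).trans (hi i h),
        fun i h => (le_max_right _ _).trans (hi i h)⟩

/-- The pieces are `{m}` and `G`. The pair of their minima lies in `𝒮₁` because `m ≥ 1` stands for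
an integer at least `2`. -/
theorem insert_mem_schreier_add_one (hα : α < ω₁) {m : ℕ} (hm : 1 ≤ m) {G : Finset ℕ}
    (hG : G ∈ schreier A α) (hmG : ∀ g ∈ G, m < g) : insert m G ∈ schreier A (α + 1) := by
  rcases G.eq_empty_or_nonempty with rfl | hne
  · exact schreier_card_le_one (add_lt_omega_one hα one_lt_omega_one) (by simp)
  · rw [schreier_add_one]
    have hlt : m < G.min' hne := hmG _ (Finset.min'_mem _ _)
    refine mem_familyComp_iff.2 ⟨{m, G.min' hne}, ?_, ?_, ?_, ?_⟩
    · intro i hi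
      have := Finset.card_le_two (a := m) (b := G.min' hne)
      simp only [Finset.mem_insert, Finset.mem_singleton] at hi
      omega
    · exact Finset.insert_subset_insert _ (by simpa using Finset.min'_mem _ _)
    · intro a ha
      refine ⟨m, by simp, ?_⟩
      rcases Finset.mem_insert.1 ha with rfl | h
      · exact le_rfl
      · exact (hmG a h).le
    · intro k hk
      simp only [Finset.mem_insert, Finset.mem_singleton] at hk
      rcases hk with rfl | rfl
      · have : segment {k, G.min' hne} (insert k G) k = {k} := by
          ext a
          simp only [mem_segment, Finset.mem_insert, Finset.mem_singleton, forall_eq_or_imp,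
            forall_eq, lt_irrefl, false_imp_iff, true_and]
          constructor
          · rintro ⟨rfl | h, h1, h2⟩
            · rfl
            · have := Finset.min'_le _ _ h
              have := h2 hlt
              omega
          · rintro rfl
            exact ⟨Or.inl rfl, le_rfl, fun h => h⟩
        rw [this]
        exact schreier_card_le_one hα (by simp)
      · have : segment {m, G.min' hne} (insert m G) (G.min' hne) = G := by
          ext a
          simp only [mem_segment, Finset.mem_insert, Finset.mem_singleton, forall_eq_or_imp,
            forall_eq, lt_irrefl, false_imp_iff, and_true]
          constructor
          · rintro ⟨rfl | h, h1, h2⟩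
            · omega
            · exact h
          · intro h
            exact ⟨Or.inr h, Finset.min'_le _ _ h, fun h => by omega⟩
        rw [this]
        exact hG

/-- After moving far enough to the right, members of `𝒮_{β+α}` belong to `𝒮_α[𝒮_β]`. -/
theorem exists_image_mem_familyComp (hβ : β < ω₁) (hα : α < ω₁) :
    ∃ M : ℕ → ℕ, ∀ F ∈ schreier A (β + α), ∀ ψ : ℕ → ℕ, StrictMonoOn ψ F → (∀ i ∈ F, M i ≤ ψ i) →
      F.image ψ ∈ familyComp (schreier A α) (schreier A β) := by
  have hsub : ∀ γ < ω₁, schreier A β ⊆ familyComp (schreier A γ) (schreier A β) := fun γ hγ =>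
    mem_familyComp_of_singletons (schreier_card_le_one hγ (by simp))
      (fun m => schreier_card_le_one hγ (by simp))
  induction α using Ordinal.limitRecOn with
  | zero =>
    refine ⟨id, fun F hF ψ hψ hle => hsub _ hα ?_⟩
    rw [add_zero] at hF
    exact schreier_spreading hβ F hF ψ hψ hle
  | add_one α ih =>
    obtain ⟨M, hM⟩ := ih ((lt_add_one α).trans hα)
    -- The bound `M i` serves the pieces in `𝒮_{β+α}`; the bound `i` makes `ψ` a spreading, as
    -- needed for the set of their minima in `𝒮₁`.
    refine ⟨fun i => max (M i) i, fun F hF ψ hψ hle => ?_⟩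
    rw [← add_assoc, schreier_add_one] at hF
    rw [schreier_add_one]
    refine familyComp_assoc (image_mem_familyComp hψ ?_ ?_ hF)
    · exact fun K hK hKF => schreierOne_spreading K hK ψ (hψ.mono (by exact_mod_cast hKF))
        fun i hi => (le_max_right _ _).trans (hle i (hKF hi))
    · exact fun K hK hKF => hM K hK ψ (hψ.mono (by exact_mod_cast hKF))
        fun i hi => (le_max_left _ _).trans (hle i (hKF hi))
  | limit α hlim ih =>
    have hlim' : Order.IsSuccLimit (β + α) := Ordinal.isSuccLimit_add β hlim
    have hlt' : β + α < ω₁ := add_lt_omega_one hβ hα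
    -- The sequence chosen at `β + α` is unrelated to the one at `α`: its terms are either at most
    -- `β` or of the form `β + α'` with `α' < α`. Each term gets its own `M`.
    have key : ∀ n, ∃ M : ℕ → ℕ, ∀ F ∈ schreier A (A.seq (β + α) n), ∀ ψ : ℕ → ℕ,
        StrictMonoOn ψ F → (∀ i ∈ F, M i ≤ ψ i) →
          F.image ψ ∈ familyComp (schreier A α) (schreier A β) := by
      intro n
      have hθ := A.lt _ hlim' hlt' n
      rcases le_total (A.seq (β + α) n) β with h | h
      · obtain ⟨k, hk⟩ := schreier_eventually_subset (A := A) hβ h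
        refine ⟨fun i => max i k, fun F hF ψ hψ hle => hsub _ hα (hk _ ?_ ?_)⟩
        · exact schreier_spreading (h.trans_lt hβ) F hF ψ hψ
            fun i hi => (le_max_left _ _).trans (hle i hi)
        · intro i hi
          obtain ⟨j, hj, rfl⟩ := Finset.mem_image.1 hi
          exact (le_max_right _ _).trans (hle j hj)
      · obtain ⟨α', hα'⟩ : ∃ α', A.seq (β + α) n = β + α' :=
          ⟨_, (Ordinal.add_sub_cancel_of_le h).symm⟩
        have hlt : α' < α := by
          rw [hα'] at hθ
          exact lt_of_add_lt_add_left hθ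
        obtain ⟨M, hM⟩ := ih α' hlt (hlt.trans hα)
        obtain ⟨k, hk⟩ := schreier_eventually_subset (A := A) hα hlt.le
        refine ⟨fun i => max (M i) k, fun F hF ψ hψ hle => ?_⟩
        rw [hα'] at hF
        obtain ⟨K, hK, hKF, h1, h2⟩ := mem_familyComp_iff.1
          (hM F hF ψ hψ fun i hi => (le_max_left _ _).trans (hle i hi))
        refine mem_familyComp_iff.2 ⟨K, hk K hK fun i hi => ?_, hKF, h1, h2⟩
        obtain ⟨j, hj, rfl⟩ := Finset.mem_image.1 (hKF hi)
        exact (le_max_right _ _).trans (hle j hj)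
    choose M hM using key
    -- The index `n` witnessing membership at the limit satisfies `n ≤ i` for all `i ∈ F`, so a
    -- maximum over the first `i + 1` functions covers it.
    refine ⟨fun i => (Finset.range (i + 1)).sup fun n => M n i, fun F hF ψ hψ hle => ?_⟩
    rw [schreier_limit A hlim' hlt'] at hF
    obtain ⟨n, hF, hn⟩ := hF
    refine hM n F hF ψ hψ fun i hi => le_trans ?_ (hle i hi)
    exact Finset.le_sup (f := fun n => M n i)
      (Finset.mem_range.2 (Nat.lt_succ_of_le (hn i hi)))

/-! ### Block sequences -/

/-- The least element of the support of `c` (`0` if `c = 0`). -/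
noncomputable def minSupp (c : ℕ →₀ ℝ) : ℕ := sInf (c.support : Set ℕ)

theorem minSupp_mem {c : ℕ →₀ ℝ} (hc : c ≠ 0) : minSupp c ∈ c.support := by
  have h : (c.support : Set ℕ).Nonempty := by exact_mod_cast Finsupp.support_nonempty_iff.2 hc
  exact_mod_cast Nat.sInf_mem h

theorem minSupp_le {c : ℕ →₀ ℝ} {a : ℕ} (ha : a ∈ c.support) : minSupp c ≤ a :=
  Nat.sInf_le (by exact_mod_cast ha)

theorem min'_support {c : ℕ →₀ ℝ} (h : c.support.Nonempty) : c.support.min' h = minSupp c :=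
  le_antisymm (Finset.min'_le _ _ (minSupp_mem (Finsupp.support_nonempty_iff.1 h)))
    (minSupp_le (Finset.min'_mem _ _))

theorem minSupp_eq {c : ℕ →₀ ℝ} {m : ℕ} (hm : m ∈ c.support) (h : ∀ a ∈ c.support, m ≤ a) :
    minSupp c = m :=
  le_antisymm (minSupp_le hm) (h _ (minSupp_mem fun h0 => by simp [h0] at hm))

theorem IsBlock.minSupp_strictMono {ι : Type*} [Preorder ι] {c : ι → ℕ →₀ ℝ} (hc : IsBlock c) :
    StrictMono fun i => minSupp (c i) :=
  fun i j h => hc.2 i j h _ (minSupp_mem (hc.1 i)) _ (minSupp_mem (hc.1 j))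

theorem isBlock_of_succ {c : ℕ → ℕ →₀ ℝ} (h0 : ∀ i, c i ≠ 0)
    (h : ∀ i, ∀ a ∈ (c i).support, ∀ b ∈ (c (i + 1)).support, a < b) : IsBlock c := by
  refine ⟨h0, fun i j hij => ?_⟩
  induction j, hij using Nat.le_induction with
  | base => exact h i
  | succ j _ ih =>
    intro a ha b hb
    exact (ih a ha _ (minSupp_mem (h0 j))).trans (h j _ (minSupp_mem (h0 j)) b hb)

theorem IsBlock.eq_of_mem {ι : Type*} [LinearOrder ι] {c : ι → ℕ →₀ ℝ} (hc : IsBlock c) {i j : ι}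
    {a : ℕ} (hi : a ∈ (c i).support) (hj : a ∈ (c j).support) : i = j := by
  rcases lt_trichotomy i j with h | h | h
  · exact absurd (hc.2 i j h a hi a hj) (lt_irrefl _)
  · exact h
  · exact absurd (hc.2 j i h a hj a hi) (lt_irrefl _)

section Composition

variable {c : ℕ → ℕ →₀ ℝ}

theorem IsBlock.linearCombination_apply (hc : IsBlock c) (d : ℕ →₀ ℝ) {j a : ℕ}
    (ha : a ∈ (c j).support) : Finsupp.linearCombination ℝ c d a = d j * c j a := by
  rw [Finsupp.linearCombination_apply, Finsupp.sum, Finsupp.finsetSum_apply]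
  rw [Finset.sum_eq_single j]
  · simp
  · intro i _ hij
    have : a ∉ (c i).support := fun h => hij (hc.eq_of_mem h ha)
    simp [Finsupp.notMem_support_iff.1 this]
  · intro h
    simp [Finsupp.notMem_support_iff.1 h]

theorem IsBlock.mem_support_linearCombination (hc : IsBlock c) {d : ℕ →₀ ℝ} {a : ℕ} :
    a ∈ (Finsupp.linearCombination ℝ c d).support ↔ ∃ j ∈ d.support, a ∈ (c j).support := by
  constructor
  · intro h
    by_contra! hcon
    refine Finsupp.mem_support_iff.1 h ?_
    rw [Finsupp.linearCombination_apply, Finsupp.sum, Finsupp.finsetSum_apply]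
    refine Finset.sum_eq_zero fun j hj => ?_
    simp [Finsupp.notMem_support_iff.1 (hcon j hj)]
  · rintro ⟨j, hj, ha⟩
    rw [Finsupp.mem_support_iff, hc.linearCombination_apply d ha]
    exact mul_ne_zero (Finsupp.mem_support_iff.1 hj) (Finsupp.mem_support_iff.1 ha)

theorem IsBlock.linearCombination_ne_zero (hc : IsBlock c) {d : ℕ →₀ ℝ} (hd : d ≠ 0) :
    Finsupp.linearCombination ℝ c d ≠ 0 := by
  rw [← Finsupp.support_nonempty_iff] at hd ⊢
  obtain ⟨j, hj⟩ := hd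
  exact ⟨_, hc.mem_support_linearCombination.2 ⟨j, hj, minSupp_mem (hc.1 j)⟩⟩

theorem IsBlock.minSupp_linearCombination (hc : IsBlock c) {d : ℕ →₀ ℝ} (hd : d ≠ 0) :
    minSupp (Finsupp.linearCombination ℝ c d) = minSupp (c (minSupp d)) := by
  refine minSupp_eq
    (hc.mem_support_linearCombination.2 ⟨_, minSupp_mem hd, minSupp_mem (hc.1 _)⟩) ?_
  intro a ha
  obtain ⟨j, hj, h⟩ := hc.mem_support_linearCombination.1 ha
  exact (hc.minSupp_strictMono.monotone (minSupp_le hj)).trans (minSupp_le h)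

theorem IsBlock.comp {ι : Type*} [LT ι] (hc : IsBlock c) {d : ι → ℕ →₀ ℝ} (hd : IsBlock d) :
    IsBlock fun i => Finsupp.linearCombination ℝ c (d i) := by
  refine ⟨fun i => hc.linearCombination_ne_zero (hd.1 i), fun i j hij a ha b hb => ?_⟩
  obtain ⟨k, hk, h1⟩ := hc.mem_support_linearCombination.1 ha
  obtain ⟨l, hl, h2⟩ := hc.mem_support_linearCombination.1 hb
  exact hc.2 k l (hd.2 i j hij k hk l hl) a h1 b h2

end Composition

theorem isBlock_single {φ : ℕ → ℕ} (hφ : StrictMono φ) :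
    IsBlock fun i => Finsupp.single (φ i) (1 : ℝ) := by
  refine ⟨fun i => by simp, fun i j hij a ha b hb => ?_⟩
  rw [Finsupp.support_single _ one_ne_zero, Finset.mem_singleton] at ha hb
  subst ha hb
  exact hφ hij

theorem minSupp_single (i : ℕ) : minSupp (Finsupp.single i (1 : ℝ)) = i :=
  minSupp_eq (by simp) (by simp [Finsupp.support_single])

section
variable {E : Type*} [NormedAddCommGroup E] [NormedSpace ℝ E]

theorem linearCombination_comp (x : ℕ → E) (c : ℕ → ℕ →₀ ℝ) (d : ℕ →₀ ℝ) :
    Finsupp.linearCombination ℝ (fun i => Finsupp.linearCombination ℝ x (c i)) d =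
      Finsupp.linearCombination ℝ x (Finsupp.linearCombination ℝ c d) :=
  (Finsupp.apply_linearCombination ℝ (Finsupp.linearCombination ℝ x) c d).symm

theorem isBlockBasis_iff {x y : ℕ → E} : IsBlockBasis x y ↔
    ∃ c : ℕ → ℕ →₀ ℝ, IsBlock c ∧ y = fun i => Finsupp.linearCombination ℝ x (c i) := by
  simp only [IsBlockBasis, funext_iff]

theorem IsBlockBasis.trans {x y z : ℕ → E} (hxy : IsBlockBasis x y) (hyz : IsBlockBasis y z) :
    IsBlockBasis x z := by
  obtain ⟨c, hc, rfl⟩ := isBlockBasis_iff.1 hxy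
  obtain ⟨d, hd, rfl⟩ := isBlockBasis_iff.1 hyz
  exact ⟨_, hc.comp hd, fun i => linearCombination_comp x c (d i)⟩

theorem isBlockBasis_comp (x : ℕ → E) {φ : ℕ → ℕ} (hφ : StrictMono φ) :
    IsBlockBasis x fun i => x (φ i) :=
  ⟨_, isBlock_single hφ, fun i => by simp⟩

theorem isBlockBasis_refl (x : ℕ → E) : IsBlockBasis x x := isBlockBasis_comp x strictMono_id

theorem isBlockBasis_tail (x : ℕ → E) (n : ℕ) : IsBlockBasis x fun i => x (n + i) :=
  isBlockBasis_comp x fun _ _ h => by simpa using h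

theorem IsBlock.le_minSupp {c : ℕ → ℕ →₀ ℝ} (hc : IsBlock c) (i : ℕ) : i ≤ minSupp (c i) :=
  hc.minSupp_strictMono.le_apply

/-- The coefficients `c` moved to the left by `n` places. -/
noncomputable def shiftLeft (n : ℕ) (c : ℕ →₀ ℝ) : ℕ →₀ ℝ :=
  c.comapDomain (fun i => n + i) fun _ _ _ _ h => by simpa using h

theorem mem_support_shiftLeft {n : ℕ} {c : ℕ →₀ ℝ} {a : ℕ} :
    a ∈ (shiftLeft n c).support ↔ n + a ∈ c.support := by
  simp only [Finsupp.mem_support_iff]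
  exact Iff.rfl

theorem linearCombination_shiftLeft (x : ℕ → E) {n : ℕ} {c : ℕ →₀ ℝ}
    (h : ∀ a ∈ c.support, n ≤ a) :
    Finsupp.linearCombination ℝ (fun i => x (n + i)) (shiftLeft n c) =
      Finsupp.linearCombination ℝ x c := by
  rw [Finsupp.linearCombination_apply, Finsupp.linearCombination_apply, Finsupp.sum, Finsupp.sum]
  refine Finset.sum_bij (fun a _ => n + a) (fun a ha => mem_support_shiftLeft.1 ha)
    (fun a _ b _ h => by simpa using h) (fun b hb => ⟨b - n, ?_, ?_⟩) (fun a _ => rfl)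
  · rw [mem_support_shiftLeft, Nat.add_sub_cancel' (h b hb)]
    exact hb
  · exact Nat.add_sub_cancel' (h b hb)

/-- The `i`-th block starts no earlier than position `i`, so the blocks from the `n`-th on only
involve the tail of `x`. -/
theorem IsBlockBasis.tail {x y : ℕ → E} (h : IsBlockBasis x y) (n : ℕ) :
    IsBlockBasis (fun i => x (n + i)) fun i => y (n + i) := by
  obtain ⟨c, hc, hy⟩ := h
  have hle : ∀ i, ∀ a ∈ (c (n + i)).support, n ≤ a := fun i a ha => by
    have h1 := hc.le_minSupp (n + i)
    have h2 := minSupp_le ha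
    omega
  refine ⟨fun i => shiftLeft n (c (n + i)), ⟨fun i h0 => ?_, fun i j hij a ha b hb => ?_⟩,
    fun i => ?_⟩
  · have h1 := minSupp_mem (hc.1 (n + i))
    have : minSupp (c (n + i)) - n ∈ (shiftLeft n (c (n + i))).support := by
      rw [mem_support_shiftLeft, Nat.add_sub_cancel' (hle i _ h1)]
      exact h1
    simp [h0] at this
  · have := hc.2 (n + i) (n + j) (by omega) _ (mem_support_shiftLeft.1 ha) _
      (mem_support_shiftLeft.1 hb)
    omega
  · simp only
    rw [linearCombination_shiftLeft x (hle i), hy]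

/-- The diagonal of a decreasing chain of block bases is a block basis of the first one. -/
theorem isBlockBasis_diagonal {y : ℕ → ℕ → E} (h : ∀ n, IsBlockBasis (y n) (y (n + 1))) :
    IsBlockBasis (y 0) fun n => y n n := by
  choose d hd hy using h
  -- `C k` holds the coefficients of `y k` with respect to `y 0`.
  let C : ℕ → ℕ → ℕ →₀ ℝ := fun k =>
    Nat.rec (fun i => Finsupp.single i 1)
      (fun k Ck i => Finsupp.linearCombination ℝ Ck (d k i)) k
  have hC : ∀ k, IsBlock (C k) ∧ y k = fun i => Finsupp.linearCombination ℝ (y 0) (C k i) := by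
    intro k
    induction k with
    | zero => exact ⟨isBlock_single strictMono_id, by simp [C]⟩
    | succ k ih =>
      refine ⟨ih.1.comp (hd k), funext fun i => ?_⟩
      rw [hy k i]
      conv_lhs => rw [ih.2]
      exact linearCombination_comp _ _ _
  refine ⟨fun k => C k k, isBlock_of_succ (fun k => (hC k).1.1 k) fun k a ha b hb => ?_,
    fun k => congrFun (hC k).2 k⟩
  -- The vector `y (k + 1) (k + 1)` is a combination of `y k j` with `j ≥ k + 1`, hence lies to the
  -- right of `y k k`.
  obtain ⟨j, hj, hb'⟩ := (hC k).1.mem_support_linearCombination.1 hb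
  refine (hC k).1.2 k j ?_ a ha b hb'
  have := (hd k).le_minSupp (k + 1)
  have := minSupp_le hj
  omega

theorem isBlockBasis_diagonal_tail {y : ℕ → ℕ → E} (h : ∀ n, IsBlockBasis (y n) (y (n + 1)))
    (n : ℕ) : IsBlockBasis (y n) fun i => y (n + i) (n + i) :=
  (isBlockBasis_tail (y n) n).trans
    (isBlockBasis_diagonal (y := fun k i => y (n + k) (n + i)) fun k => (h (n + k)).tail n)

/-- Diagonalization: countably many properties, each of which can be attained by passing to a block
basis, are attained by block bases having a tail of a single block basis as a block basis. -/
theorem exists_isBlockBasis_diagonal {P : ℕ → (ℕ → E) → Prop} {x : ℕ → E}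
    (h : ∀ n y, IsBlockBasis x y → ∃ z, IsBlockBasis y z ∧ P n z) :
    ∃ z, IsBlockBasis x z ∧
      ∀ n, ∃ y, IsBlockBasis x y ∧ P n y ∧ IsBlockBasis y fun i => z (n + i) := by
  choose! f hf hP using h
  let y : ℕ → ℕ → E := fun n => Nat.rec (f 0 x) (fun n y => f (n + 1) y) n
  have hy : ∀ n, IsBlockBasis x (y n) ∧ P n (y n) := by
    intro n
    induction n with
    | zero => exact ⟨hf 0 x (isBlockBasis_refl x), hP 0 x (isBlockBasis_refl x)⟩
    | succ n ih => exact ⟨ih.1.trans (hf (n + 1) _ ih.1), hP (n + 1) _ ih.1⟩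
  have hstep : ∀ n, IsBlockBasis (y n) (y (n + 1)) := fun n => hf (n + 1) _ (hy n).1
  exact ⟨fun n => y n n, (hy 0).1.trans (isBlockBasis_diagonal hstep),
    fun n => ⟨y n, (hy n).1, (hy n).2, isBlockBasis_diagonal_tail hstep n⟩⟩

/-! ### Nondegenerate sequences -/

/-- `p` is a norm on the span of the linearly independent sequence `x`. -/
def Nondegenerate (p : Seminorm ℝ E) (x : ℕ → E) : Prop :=
  ∀ c : ℕ →₀ ℝ, c ≠ 0 → 0 < p (Finsupp.linearCombination ℝ x c)

theorem Nondegenerate.pos {p : Seminorm ℝ E} {x : ℕ → E} (hx : Nondegenerate p x) (i : ℕ) :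
    0 < p (x i) := by
  simpa using hx (Finsupp.single i 1) (by simp)

theorem Nondegenerate.block {p : Seminorm ℝ E} {x y : ℕ → E} (hx : Nondegenerate p x)
    (h : IsBlockBasis x y) : Nondegenerate p y := by
  obtain ⟨c, hc, rfl⟩ := isBlockBasis_iff.1 h
  intro d hd
  rw [linearCombination_comp]
  exact hx _ (hc.linearCombination_ne_zero hd)

/-! ### The constants `δ` -/

theorem isAdmissible_iff {ℱ : Set (Finset ℕ)} {k : ℕ} {c : Fin k → ℕ →₀ ℝ} :
    IsAdmissible ℱ c ↔ IsBlock c ∧ Finset.univ.image (fun i => minSupp (c i)) ∈ ℱ := by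
  simp only [IsAdmissible, min'_support, exists_prop]

/-- The lower `ℓ₁` estimate with constant `δ` holds for `ℱ`-admissible blocks of `x`. -/
def LowerEstimate (ℱ : Set (Finset ℕ)) (p : Seminorm ℝ E) (x : ℕ → E) (δ : ℝ) : Prop :=
  ∀ (k : ℕ) (c : Fin k → ℕ →₀ ℝ), IsAdmissible ℱ c →
    δ * ∑ i, p (Finsupp.linearCombination ℝ x (c i)) ≤
      p (∑ i, Finsupp.linearCombination ℝ x (c i))

variable {ℱ 𝒢 : Set (Finset ℕ)} {p : Seminorm ℝ E} {x y : ℕ → E} {δ : ℝ}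

theorem LowerEstimate.zero : LowerEstimate ℱ p x 0 := fun k c _ => by simp

theorem LowerEstimate.le_one (hx : Nondegenerate p x) (hℱ : {0} ∈ ℱ)
    (h : LowerEstimate ℱ p x δ) : δ ≤ 1 := by
  have h1 := h 1 (fun _ => Finsupp.single 0 1) (isAdmissible_iff.2
    ⟨⟨fun i => by simp, fun i j hij => by omega⟩, by simpa [minSupp_single] using hℱ⟩)
  simp only [Finset.univ_unique, Finset.sum_const, Finset.card_singleton, one_smul,
    Finsupp.linearCombination_single] at h1
  have := hx.pos 0
  nlinarith

theorem bddAbove_lowerEstimate (hx : Nondegenerate p x) (hℱ : {0} ∈ ℱ) :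
    BddAbove {δ : ℝ | 0 ≤ δ ∧ LowerEstimate ℱ p x δ} :=
  ⟨1, fun _ h => LowerEstimate.le_one hx hℱ h.2⟩

theorem delta_nonneg : 0 ≤ delta ℱ p x :=
  Real.sSup_nonneg fun _ h => h.1

theorem delta_le_one (hx : Nondegenerate p x) (hℱ : {0} ∈ ℱ) : delta ℱ p x ≤ 1 :=
  csSup_le ⟨0, le_rfl, LowerEstimate.zero⟩ fun _ h => LowerEstimate.le_one hx hℱ h.2

theorem LowerEstimate.le_delta (hx : Nondegenerate p x) (hℱ : {0} ∈ ℱ) (h0 : 0 ≤ δ)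
    (h : LowerEstimate ℱ p x δ) : δ ≤ delta ℱ p x :=
  le_csSup (bddAbove_lowerEstimate hx hℱ) ⟨h0, h⟩

theorem LowerEstimate.mono {δ' : ℝ} (h : LowerEstimate ℱ p x δ) (hle : δ' ≤ δ) :
    LowerEstimate ℱ p x δ' := fun k c hc =>
  (mul_le_mul_of_nonneg_right hle (Finset.sum_nonneg fun _ _ => apply_nonneg p _)).trans (h k c hc)

/-- The supremum is attained, since each of the inequalities is a closed condition on `δ`. -/
theorem lowerEstimate_delta : LowerEstimate ℱ p x (delta ℱ p x) := by
  intro k c hc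
  have h0 : 0 ≤ ∑ i, p (Finsupp.linearCombination ℝ x (c i)) :=
    Finset.sum_nonneg fun _ _ => apply_nonneg p _
  rcases h0.eq_or_lt with h | h
  · rw [← h, mul_zero]
    exact apply_nonneg p _
  · rw [← le_div_iff₀ h]
    exact csSup_le ⟨0, le_rfl, LowerEstimate.zero⟩ fun δ hδ => (le_div_iff₀ h).2 (hδ.2 k c hc)

/-- Comparison of the lower estimates of a sequence and a block basis of it. -/
theorem LowerEstimate.block {c : ℕ → ℕ →₀ ℝ} (hc : IsBlock c)
    (hℱ : ∀ F ∈ ℱ, F.image (fun i => minSupp (c i)) ∈ 𝒢) (h : LowerEstimate 𝒢 p x δ) :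
    LowerEstimate ℱ p (fun i => Finsupp.linearCombination ℝ x (c i)) δ := by
  intro k d hd
  rw [isAdmissible_iff] at hd
  simp only [linearCombination_comp]
  refine h k _ (isAdmissible_iff.2 ⟨hc.comp hd.1, ?_⟩)
  convert hℱ _ hd.2 using 1
  rw [Finset.image_image]
  refine Finset.image_congr fun i _ => ?_
  exact hc.minSupp_linearCombination (hd.1.1 i)

theorem LowerEstimate.of_isBlockBasis (hℱ : IsSpreading ℱ) (hxy : IsBlockBasis x y)
    (h : LowerEstimate ℱ p x δ) : LowerEstimate ℱ p y δ := by
  obtain ⟨c, hc, rfl⟩ := isBlockBasis_iff.1 hxy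
  exact h.block hc fun F hF => hℱ F hF _ (hc.minSupp_strictMono.strictMonoOn _)
    fun i _ => hc.le_minSupp i

theorem LowerEstimate.subsequence {φ : ℕ → ℕ} (hφ : StrictMono φ)
    (hℱ : ∀ F ∈ ℱ, F.image φ ∈ 𝒢) (h : LowerEstimate 𝒢 p x δ) :
    LowerEstimate ℱ p (fun i => x (φ i)) δ := by
  have := h.block (ℱ := ℱ) (isBlock_single hφ) (by simpa only [minSupp_single] using hℱ)
  simpa using this

theorem delta_le_of_isBlockBasis (hx : Nondegenerate p x) (h0 : {0} ∈ ℱ) (hℱ : IsSpreading ℱ)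
    (hxy : IsBlockBasis x y) : delta ℱ p x ≤ delta ℱ p y :=
  (lowerEstimate_delta.of_isBlockBasis hℱ hxy).le_delta (hx.block hxy) h0 delta_nonneg

/-! ### The constants `δ̇` -/

theorem bddAbove_deltaDot (hx : Nondegenerate p x) (h0 : {0} ∈ ℱ) :
    BddAbove {d : ℝ | ∃ y, IsBlockBasis x y ∧ d = delta ℱ p y} := by
  refine ⟨1, ?_⟩
  rintro _ ⟨y, hy, rfl⟩
  exact delta_le_one (hx.block hy) h0

theorem delta_le_deltaDot (hx : Nondegenerate p x) (h0 : {0} ∈ ℱ) (hxy : IsBlockBasis x y) :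
    delta ℱ p y ≤ deltaDot ℱ p x :=
  le_csSup (bddAbove_deltaDot hx h0) ⟨y, hxy, rfl⟩

theorem deltaDot_le {C : ℝ} (h : ∀ y, IsBlockBasis x y → delta ℱ p y ≤ C) :
    deltaDot ℱ p x ≤ C := by
  refine csSup_le ⟨_, x, isBlockBasis_refl x, rfl⟩ ?_
  rintro _ ⟨y, hy, rfl⟩
  exact h y hy

theorem deltaDot_nonneg : 0 ≤ deltaDot ℱ p x := by
  refine Real.sSup_nonneg ?_
  rintro _ ⟨y, -, rfl⟩
  exact delta_nonneg

theorem exists_lt_delta {C : ℝ} (h : C < deltaDot ℱ p x) :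
    ∃ y, IsBlockBasis x y ∧ C < delta ℱ p y := by
  by_contra! hcon
  exact absurd (deltaDot_le hcon) (not_le.2 h)

theorem deltaDot_anti (hx : Nondegenerate p x) (h0 : {0} ∈ ℱ) (hxy : IsBlockBasis x y) :
    deltaDot ℱ p y ≤ deltaDot ℱ p x :=
  deltaDot_le fun _ hz => delta_le_deltaDot hx h0 (hxy.trans hz)

/-- Dropping the first `n` terms of a block basis does not lower `delta`, and what remains is a
block basis of the tail. -/
theorem deltaDot_tail (hx : Nondegenerate p x) (h0 : {0} ∈ ℱ) (hℱ : IsSpreading ℱ) (n : ℕ) :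
    deltaDot ℱ p (fun i => x (n + i)) = deltaDot ℱ p x := by
  have hn := isBlockBasis_tail x n
  refine le_antisymm (deltaDot_anti hx h0 hn) (deltaDot_le fun y hy => ?_)
  exact (delta_le_of_isBlockBasis (hx.block hy) h0 hℱ (isBlockBasis_tail y n)).trans
    (delta_le_deltaDot (hx.block hn) h0 (hy.tail n))

end

section
variable {E : Type*} [NormedAddCommGroup E] [NormedSpace ℝ E]
variable {ℱ 𝒢 : Set (Finset ℕ)} {p : Seminorm ℝ E} {x y : ℕ → E} {δ c : ℝ}

/-! ### Sequences with a lower `ℓ₁` estimate -/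

/-- The weighted `ℓ₁` norm `∑ |a_i| p(x_i)`. -/
noncomputable def weight (p : Seminorm ℝ E) (x : ℕ → E) (a : ℕ →₀ ℝ) : ℝ :=
  a.sum fun i t => |t| * p (x i)

/-- The lower estimate `c ∑ |a_i| p(x_i) ≤ p(∑ a_i x_i)`. -/
def EllOneEstimate (p : Seminorm ℝ E) (x : ℕ → E) (c : ℝ) : Prop :=
  ∀ a : ℕ →₀ ℝ, c * weight p x a ≤ p (Finsupp.linearCombination ℝ x a)

theorem weight_nonneg (a : ℕ →₀ ℝ) : 0 ≤ weight p x a :=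
  Finset.sum_nonneg fun _ _ => mul_nonneg (abs_nonneg _) (apply_nonneg p _)

theorem seminorm_sum_le {ι : Type*} (p : Seminorm ℝ E) (s : Finset ι) (f : ι → E) :
    p (∑ i ∈ s, f i) ≤ ∑ i ∈ s, p (f i) :=
  Finset.le_sum_of_subadditive p (map_zero p).le (map_add_le_add p) s f

theorem seminorm_le_weight (a : ℕ →₀ ℝ) : p (Finsupp.linearCombination ℝ x a) ≤ weight p x a := by
  rw [Finsupp.linearCombination_apply]
  refine (seminorm_sum_le p _ _).trans (Finset.sum_le_sum fun i _ => ?_)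
  rw [map_smul_eq_mul, Real.norm_eq_abs]

theorem weight_smul (t : ℝ) (a : ℕ →₀ ℝ) : weight p x (t • a) = |t| * weight p x a := by
  unfold weight
  rw [Finsupp.sum_smul_index (by simp), Finsupp.mul_sum]
  simp [abs_mul, mul_assoc]

theorem weight_zero : weight p x 0 = 0 := Finsupp.sum_zero_index

theorem weight_sum {ι : Type*} (s : Finset ι) (f : ι → ℕ →₀ ℝ)
    (h : ∀ i j, i ≠ j → Disjoint (f i).support (f j).support) :
    weight p x (∑ i ∈ s, f i) = ∑ i ∈ s, weight p x (f i) := by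
  classical
  induction s using Finset.induction_on with
  | empty => simp [weight_zero]
  | insert i s hi ih =>
    rw [Finset.sum_insert hi, Finset.sum_insert hi, ← ih]
    refine Finsupp.sum_add_index_of_disjoint ?_ _
    refine Finset.disjoint_of_subset_right Finsupp.support_finsetSum ?_
    rw [Finset.disjoint_biUnion_right]
    exact fun j hj => h i j (by rintro rfl; exact hi hj)

theorem IsBlock.disjoint {ι : Type*} [LinearOrder ι] {c : ι → ℕ →₀ ℝ} (hc : IsBlock c) {i j : ι}
    (hij : i ≠ j) : Disjoint (c i).support (c j).support :=
  Finset.disjoint_left.2 fun _ hi hj => hij (hc.eq_of_mem hi hj)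

theorem weight_linearCombination {d : ℕ → ℕ →₀ ℝ} (hd : IsBlock d) (a : ℕ →₀ ℝ) :
    weight p x (Finsupp.linearCombination ℝ d a) = a.sum fun i t => |t| * weight p x (d i) := by
  rw [Finsupp.linearCombination_apply, Finsupp.sum, weight_sum]
  · simp only [weight_smul]
    rfl
  · exact fun i j hij => Finset.disjoint_of_subset_left Finsupp.support_smul
      (Finset.disjoint_of_subset_right Finsupp.support_smul (hd.disjoint hij))

theorem EllOneEstimate.block (hc : 0 ≤ c) (h : EllOneEstimate p x c) (hxy : IsBlockBasis x y) :
    EllOneEstimate p y c := by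
  obtain ⟨d, hd, rfl⟩ := isBlockBasis_iff.1 hxy
  intro a
  rw [linearCombination_comp]
  refine le_trans (mul_le_mul_of_nonneg_left ?_ hc) (h _)
  rw [weight_linearCombination hd]
  exact Finset.sum_le_sum fun i _ => mul_le_mul_of_nonneg_left (seminorm_le_weight _) (abs_nonneg _)

theorem EllOneEstimate.lowerEstimate (hc : 0 ≤ c) (h : EllOneEstimate p x c) :
    LowerEstimate ℱ p x c := by
  intro k d hd
  have hd' := (isAdmissible_iff.1 hd).1
  rw [← map_sum (Finsupp.linearCombination ℝ x)]
  refine le_trans (mul_le_mul_of_nonneg_left ?_ hc) (h _)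
  rw [weight_sum _ _ fun i j hij => hd'.disjoint hij]
  exact Finset.sum_le_sum fun i _ => seminorm_le_weight _

/-- James's theorem on the distortion of `ℓ₁`, for block bases. -/
theorem EllOneEstimate.exists_improvement (hx : Nondegenerate p x) (hc : 0 < c)
    (h : EllOneEstimate p x c) {ε : ℝ} (hε : 0 < ε) (hε1 : ε < 1) :
    ∃ y, IsBlockBasis x y ∧ EllOneEstimate p y (1 - ε) := by
  -- `S n` collects the values of `p` on the weighted `ℓ₁` sphere of the vectors supported from `n`
  -- on. Its infimum is trapped between `c` and `1`; `l` is the supremum of these infima.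
  let S : ℕ → Set ℝ := fun n => {t | ∃ a : ℕ →₀ ℝ, weight p x a = 1 ∧
    (∀ i ∈ a.support, n ≤ i) ∧ t = p (Finsupp.linearCombination ℝ x a)}
  have hSbdd : ∀ n, ∀ t ∈ S n, c ≤ t := by
    rintro n _ ⟨a, ha, -, rfl⟩
    simpa [ha] using h a
  have hSmem : ∀ n, (1 : ℝ) ∈ S n := by
    intro n
    have hn := hx.pos n
    refine ⟨Finsupp.single n (p (x n))⁻¹, ?_, ?_, ?_⟩
    · rw [weight, Finsupp.sum_single_index (by simp), abs_of_pos (inv_pos.2 hn),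
        inv_mul_cancel₀ hn.ne']
    · intro i hi
      rw [Finsupp.support_single _ (inv_pos.2 hn).ne', Finset.mem_singleton] at hi
      omega
    · rw [Finsupp.linearCombination_single, map_smul_eq_mul, Real.norm_eq_abs,
        abs_of_pos (inv_pos.2 hn), inv_mul_cancel₀ hn.ne']
  have hbb : ∀ n, BddBelow (S n) := fun n => ⟨c, fun t => hSbdd n t⟩
  have hl1 : ∀ n, sInf (S n) ≤ 1 := fun n => csInf_le (hbb n) (hSmem n)
  have hlc : ∀ n, c ≤ sInf (S n) := fun n => le_csInf ⟨1, hSmem n⟩ (hSbdd n)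
  have hba : BddAbove (range fun n => sInf (S n)) := ⟨1, by rintro _ ⟨n, rfl⟩; exact hl1 n⟩
  set l := ⨆ n, sInf (S n) with hl
  have hle : ∀ n, sInf (S n) ≤ l := fun n => le_ciSup hba n
  have hl0 : 0 < l := hc.trans_le ((hlc 0).trans (hle 0))
  obtain ⟨N, hN⟩ : ∃ N, l * (1 - ε / 2) < sInf (S N) :=
    exists_lt_of_lt_ciSup (by rw [← hl]; nlinarith)
  have hex : ∀ n, ∃ a : ℕ →₀ ℝ, weight p x a = 1 ∧ (∀ i ∈ a.support, n ≤ i) ∧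
      p (Finsupp.linearCombination ℝ x a) < l * (1 + ε / 2) := by
    intro n
    obtain ⟨_, ⟨a, h1, h2, rfl⟩, h3⟩ := exists_lt_of_csInf_lt ⟨1, hSmem n⟩
      (lt_of_le_of_lt (hle n) (show l < l * (1 + ε / 2) by nlinarith))
    exact ⟨a, h1, h2, h3⟩
  choose f hf1 hf2 hf3 using hex
  -- Near-minimizers are chosen successively beyond `N`, each starting after the support of the
  -- preceding one. Their norms are below `l(1 + ε/2)`, while every combination of them is bounded
  -- below by the infimum at `N`, above `l(1 - ε/2)`.
  let k : ℕ → ℕ := fun n => Nat.rec N (fun _ m => (f m).support.sup id + 1) n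
  have hkN : ∀ j, ∀ i ∈ (f (k j)).support, N ≤ i := by
    intro j
    induction j with
    | zero => exact hf2 N
    | succ j ih =>
      intro i hi
      have h1 : (f (k j)).support.sup id + 1 ≤ i := hf2 _ i hi
      have hne : (f (k j)).support.Nonempty := by
        rw [Finsupp.support_nonempty_iff]
        intro h0
        have := hf1 (k j)
        rw [h0, weight_zero] at this
        norm_num at this
      obtain ⟨i', hi'⟩ := hne
      have h2 : i' ≤ (f (k j)).support.sup id := Finset.le_sup (f := id) hi'
      have := ih i' hi'
      omega
  have hblock : IsBlock fun j => f (k j) := by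
    refine isBlock_of_succ (fun j h0 => ?_) fun j a ha b hb => ?_
    · have := hf1 (k j)
      rw [h0, weight_zero] at this
      norm_num at this
    · have h1 : (f (k j)).support.sup id + 1 ≤ b := hf2 _ b hb
      have h2 : a ≤ (f (k j)).support.sup id := Finset.le_sup (f := id) ha
      omega
  refine ⟨_, ⟨_, hblock, fun _ => rfl⟩, fun a => ?_⟩
  rw [linearCombination_comp]
  set B := Finsupp.linearCombination ℝ (fun j => f (k j)) a with hB
  have hBw : weight p x B = a.sum fun _ t => |t| := by
    rw [hB, weight_linearCombination hblock]
    simp [hf1]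
  have hBN : ∀ i ∈ B.support, N ≤ i := by
    intro i hi
    obtain ⟨j, -, hj⟩ := hblock.mem_support_linearCombination.1 hi
    exact hkN j i hj
  have hlow : sInf (S N) * weight p x B ≤ p (Finsupp.linearCombination ℝ x B) := by
    rcases (weight_nonneg (p := p) (x := x) B).eq_or_lt with h0 | h0
    · rw [← h0, mul_zero]
      exact apply_nonneg p _
    · rw [← le_div_iff₀ h0]
      refine csInf_le (hbb N) ⟨(weight p x B)⁻¹ • B, ?_, ?_, ?_⟩
      · rw [weight_smul, abs_of_pos (inv_pos.2 h0), inv_mul_cancel₀ h0.ne']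
      · exact fun i hi => hBN i (Finsupp.support_smul hi)
      · rw [map_smul, map_smul_eq_mul, Real.norm_eq_abs, abs_of_pos (inv_pos.2 h0), div_eq_inv_mul]
  have hup : weight p (fun i => Finsupp.linearCombination ℝ x (f (k i))) a ≤
      l * (1 + ε / 2) * a.sum fun _ t => |t| := by
    rw [Finsupp.mul_sum]
    refine Finset.sum_le_sum fun i _ => ?_
    calc |a i| * p (Finsupp.linearCombination ℝ x (f (k i)))
        ≤ |a i| * (l * (1 + ε / 2)) := mul_le_mul_of_nonneg_left (hf3 _).le (abs_nonneg _)
      _ = l * (1 + ε / 2) * |a i| := mul_comm _ _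
  have hT : 0 ≤ a.sum fun _ t => |t| := Finset.sum_nonneg fun _ _ => abs_nonneg _
  rw [hBw] at hlow
  calc (1 - ε) * weight p (fun i => Finsupp.linearCombination ℝ x (f (k i))) a
      ≤ (1 - ε) * (l * (1 + ε / 2) * a.sum fun _ t => |t|) :=
        mul_le_mul_of_nonneg_left hup (by linarith)
    _ = ((1 - ε) * (1 + ε / 2)) * (l * a.sum fun _ t => |t|) := by ring
    -- `(1 - ε)(1 + ε/2) = 1 - ε/2 - ε²/2`.
    _ ≤ (1 - ε / 2) * (l * a.sum fun _ t => |t|) :=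
        mul_le_mul_of_nonneg_right (by nlinarith) (mul_nonneg hl0.le hT)
    _ = l * (1 - ε / 2) * a.sum fun _ t => |t| := by ring
    _ ≤ sInf (S N) * a.sum fun _ t => |t| := mul_le_mul_of_nonneg_right hN.le hT
    _ ≤ _ := hlow

/-! ### Uniform lower estimates for all Schreier families -/

/-- Blocks must be nonzero and `ℱ` is not assumed hereditary, so vanishing coefficients cannot
simply be dropped: they are replaced by a small `t`, at a cost of at most `ε`. -/
theorem LowerEstimate.sum_le (hδ : 0 ≤ δ) (h : LowerEstimate ℱ p x δ) {F : Finset ℕ} (hF : F ∈ ℱ)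
    (a : ℕ → ℝ) : δ * ∑ i ∈ F, |a i| * p (x i) ≤ p (∑ i ∈ F, a i • x i) := by
  have key : ∀ a : ℕ → ℝ, (∀ i, a i ≠ 0) →
      δ * ∑ i ∈ F, |a i| * p (x i) ≤ p (∑ i ∈ F, a i • x i) := by
    intro a ha
    let o := F.orderEmbOfFin rfl
    have hmin : ∀ j, minSupp (Finsupp.single (o j) (a (o j))) = o j := fun j =>
      minSupp_eq (by simp [ha]) (by simp [Finsupp.support_single _ (ha _)])
    have him : Finset.univ.image o = F := by
      ext m
      simp only [Finset.mem_image, Finset.mem_univ, true_and]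
      rw [← Finset.mem_coe, ← Finset.range_orderEmbOfFin F rfl]
      rfl
    have h1 := h F.card (fun j => Finsupp.single (o j) (a (o j))) (isAdmissible_iff.2
      ⟨⟨fun j => by simp [ha], fun i j hij r hr s hs => ?_⟩, by simp only [hmin]; rwa [him]⟩)
    · simp only [Finsupp.linearCombination_single, map_smul_eq_mul, Real.norm_eq_abs] at h1
      rw [← him, Finset.sum_image o.injective.injOn, Finset.sum_image o.injective.injOn]
      exact h1
    · rw [Finsupp.support_single _ (ha _), Finset.mem_singleton] at hr hs
      subst hr hs
      exact o.strictMono hij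
  refine le_of_forall_pos_le_add fun ε hε => ?_
  set K := ∑ i ∈ F, p (x i) + 1 with hK
  have hK0 : 0 < K := by
    have : 0 ≤ ∑ i ∈ F, p (x i) := Finset.sum_nonneg fun _ _ => apply_nonneg p _
    linarith
  let t : ℝ := ε / K
  have ht : 0 < t := div_pos hε hK0
  let e : ℕ → ℝ := fun i => if a i = 0 then t else 0
  have he : ∀ i, a i + e i ≠ 0 ∧ |a i| ≤ |a i + e i| ∧ |e i| ≤ t := by
    intro i
    by_cases h0 : a i = 0
    · simp [e, h0, ht.ne', abs_of_pos ht, ht.le]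
    · simp [e, h0, ht.le]
  calc δ * ∑ i ∈ F, |a i| * p (x i) ≤ δ * ∑ i ∈ F, |a i + e i| * p (x i) :=
        mul_le_mul_of_nonneg_left (Finset.sum_le_sum fun i _ =>
          mul_le_mul_of_nonneg_right (he i).2.1 (apply_nonneg p _)) hδ
    _ ≤ p (∑ i ∈ F, (a i + e i) • x i) := key _ fun i => (he i).1
    _ = p (∑ i ∈ F, a i • x i + ∑ i ∈ F, e i • x i) := by
        rw [← Finset.sum_add_distrib]
        simp [add_smul]
    _ ≤ p (∑ i ∈ F, a i • x i) + p (∑ i ∈ F, e i • x i) := map_add_le_add p _ _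
    _ ≤ p (∑ i ∈ F, a i • x i) + ε := by
        refine add_le_add_right ?_ _
        calc p (∑ i ∈ F, e i • x i) ≤ ∑ i ∈ F, p (e i • x i) := seminorm_sum_le p _ _
          _ ≤ ∑ i ∈ F, t * p (x i) := Finset.sum_le_sum fun i _ => by
              rw [map_smul_eq_mul, Real.norm_eq_abs]
              exact mul_le_mul_of_nonneg_right (he i).2.2 (apply_nonneg p _)
          _ = t * ∑ i ∈ F, p (x i) := (Finset.mul_sum _ _ _).symm
          _ ≤ t * K := mul_le_mul_of_nonneg_left (by linarith) ht.le
          _ = ε := div_mul_cancel₀ _ hK0.ne'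

/-! ### The tree of rational block sequences and its rank -/

/-- The vector with rational coefficients `r` with respect to `x`. -/
noncomputable def rationalVector (x : ℕ → E) (r : ℕ →₀ ℚ) : E :=
  Finsupp.linearCombination ℝ x (r.mapRange (fun q : ℚ => (q : ℝ)) Rat.cast_zero)

theorem exists_rationalVector_near (p : Seminorm ℝ E) (x : ℕ → E) (t : ℕ →₀ ℝ) {η : ℝ}
    (hη : 0 < η) : ∃ r : ℕ →₀ ℚ, r.support ⊆ t.support ∧
      p (rationalVector x r - Finsupp.linearCombination ℝ x t) ≤ η := by
  set K := ∑ i ∈ t.support, p (x i) + 1 with hK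
  have hK0 : 0 < K := by
    have : 0 ≤ ∑ i ∈ t.support, p (x i) := Finset.sum_nonneg fun _ _ => apply_nonneg p _
    linarith
  have hq : ∀ i, ∃ q : ℚ, |(q : ℝ) - t i| ≤ η / K ∧ (t i = 0 → q = 0) := by
    intro i
    by_cases h0 : t i = 0
    · exact ⟨0, by simp [h0]; positivity, fun _ => rfl⟩
    · obtain ⟨q, h1, h2⟩ := exists_rat_btwn (show t i < t i + η / K by
        have := div_pos hη hK0
        linarith)
      exact ⟨q, by rw [abs_of_pos (by linarith)]; linarith, fun h => absurd h h0⟩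
  choose q hq1 hq2 using hq
  refine ⟨Finsupp.onFinset t.support q fun i hi => Finsupp.mem_support_iff.2 fun h => hi (hq2 i h),
    Finsupp.support_onFinset_subset, ?_⟩
  rw [rationalVector, ← map_sub, Finsupp.linearCombination_apply,
    Finsupp.sum_of_support_subset (s := t.support) _ _ _ (by simp)]
  · calc _ ≤ ∑ i ∈ t.support, η / K * p (x i) := by
          refine (seminorm_sum_le p _ _).trans (Finset.sum_le_sum fun i _ => ?_)
          rw [map_smul_eq_mul, Real.norm_eq_abs]
          refine mul_le_mul_of_nonneg_right ?_ (apply_nonneg p _)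
          simpa using hq1 i
      _ = η / K * ∑ i ∈ t.support, p (x i) := (Finset.mul_sum _ _ _).symm
      _ ≤ η / K * K := mul_le_mul_of_nonneg_left (by linarith) (by positivity)
      _ = η := div_mul_cancel₀ _ hK0.ne'
  · intro i hi
    by_contra hcon
    refine Finsupp.mem_support_iff.1 hi ?_
    have h0 : t i = 0 := Finsupp.notMem_support_iff.1 hcon
    simp [h0, hq2 i h0]

theorem succ_lt_omega_one {α : Ordinal.{0}} (h : α < ω₁) : Order.succ α < ω₁ := by
  rw [Order.succ_eq_add_one]
  exact add_lt_omega_one h one_lt_omega_one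

/-- A rank is a supremum of countably many successors of smaller ranks. It is applied to finite sets
of rational coefficient vectors, and countability is the reason for using rational coefficients. -/
theorem rank_lt_omega_one {ι : Type} [Countable ι] (r : ι → ι → Prop) [IsWellFounded ι r] (a : ι) :
    IsWellFounded.rank r a < ω₁ := by
  induction a using IsWellFounded.induction r with
  | ind a ih =>
    rw [IsWellFounded.rank_eq]
    exact Ordinal.iSup_lt_omega_one fun b => succ_lt_omega_one (ih b b.2)

/-- The finite set `s` of rational vectors satisfies a lower `ℓ₁` estimate. -/
def FiniteEllOneEstimate (p : Seminorm ℝ E) (x : ℕ → E) (c : ℝ) (s : Finset (ℕ →₀ ℚ)) : Prop :=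
  ∀ a : (ℕ →₀ ℚ) → ℝ, c * ∑ r ∈ s, |a r| * p (rationalVector x r) ≤
    p (∑ r ∈ s, a r • rationalVector x r)

/-- `t` arises from `s` by adding a further block, and satisfies a lower `ℓ₁` estimate. -/
def Extends (p : Seminorm ℝ E) (x : ℕ → E) (c : ℝ) (t s : Finset (ℕ →₀ ℚ)) : Prop :=
  FiniteEllOneEstimate p x c t ∧ ∃ r : ℕ →₀ ℚ, r ≠ 0 ∧ t = insert r s ∧
    ∀ r' ∈ s, ∀ i ∈ r'.support, ∀ j ∈ r.support, i < j

/-- The vectors added along an infinite branch form the block basis. A finite combination of them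
involves only vectors of a single node, whose estimate applies. -/
theorem exists_ellOneEstimate_of_not_wellFounded (h : ¬ WellFounded (Extends p x c)) :
    ∃ y, IsBlockBasis x y ∧ EllOneEstimate p y c := by
  rw [wellFounded_iff_isEmpty_descending_chain, not_isEmpty_iff] at h
  obtain ⟨f, hf⟩ := h
  choose hgood r hr0 hfr hlt using hf
  have hmono : Monotone f := monotone_nat_of_le_succ fun n => by
    rw [hfr n]
    exact Finset.subset_insert _ _
  have hmem : ∀ n, r n ∈ f (n + 1) := fun n => by
    rw [hfr n]
    exact Finset.mem_insert_self _ _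
  have hsupp : ∀ s : ℕ →₀ ℚ,
      (s.mapRange (fun q : ℚ => (q : ℝ)) Rat.cast_zero).support = s.support := fun s =>
    Finsupp.support_mapRange_of_injective _ _ Rat.cast_injective
  have hblock : IsBlock fun n => (r n).mapRange (fun q : ℚ => (q : ℝ)) Rat.cast_zero := by
    refine ⟨fun n => ?_, fun i j hij a ha b hb => ?_⟩
    · rw [← Finsupp.support_nonempty_iff, hsupp, Finsupp.support_nonempty_iff]
      exact hr0 n
    · rw [hsupp] at ha hb
      exact hlt j (r i) (hmono (show i + 1 ≤ j from hij) (hmem i)) a ha b hb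
  have hinj : Function.Injective r := by
    intro i j hij
    have h1 := minSupp_mem (hblock.1 i)
    refine hblock.eq_of_mem h1 ?_
    simp only [← hij]
    exact h1
  refine ⟨_, ⟨_, hblock, fun _ => rfl⟩, fun a => ?_⟩
  let N := a.support.sup id + 1
  have hsub : a.support.image r ⊆ f N := by
    intro s hs
    obtain ⟨i, hi, rfl⟩ := Finset.mem_image.1 hs
    have : i ≤ a.support.sup id := Finset.le_sup (f := id) hi
    exact hmono (show i + 1 ≤ N by omega) (hmem i)
  -- The node may contain further vectors, including those of the initial set of the chain; they
  -- receive the coefficient `0`.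
  have hzero : ∀ s ∉ a.support.image r, Function.extend r a 0 s = 0 := by
    intro s hs
    by_cases h : ∃ i, r i = s
    · obtain ⟨i, rfl⟩ := h
      rw [hinj.extend_apply]
      by_contra hcon
      exact hs (Finset.mem_image_of_mem _ (Finsupp.mem_support_iff.2 hcon))
    · rw [Function.extend_apply' _ _ _ h]
      rfl
  have h1 := hgood (a.support.sup id) (Function.extend r a 0)
  rw [← Finset.sum_subset hsub fun s _ hs => by simp [hzero s hs],
    ← Finset.sum_subset hsub fun s _ hs => by simp [hzero s hs],
    Finset.sum_image hinj.injOn, Finset.sum_image hinj.injOn] at h1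
  simp only [hinj.extend_apply] at h1
  rw [Finsupp.linearCombination_apply]
  exact h1

/-- The hypothesis says that the node of `F` can be prolonged by all late sets of `𝒮_α`. At a
successor, one passes to the child obtained by adding an element `m`, because `{m} ∪ G ∈ 𝒮_{α+1}`
for `G ∈ 𝒮_α` beyond `m`. At a limit, every `β + 1 < α` is treated by raising `N` until late sets of
`𝒮_{β+1}` lie in `𝒮_α`. -/
theorem le_rank_of_schreier {A : LimitSequences} [IsWellFounded _ (Extends p x c)]
    {ρ : ℕ → ℕ →₀ ℚ} (hρ0 : ∀ i, ρ i ≠ 0)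
    (hρ : ∀ i j, i < j → ∀ a ∈ (ρ i).support, ∀ b ∈ (ρ j).support, a < b)
    {α : Ordinal.{0}} (hα : α < ω₁) (F : Finset ℕ) (N : ℕ) (hFN : ∀ i ∈ F, i < N)
    (h : ∀ G ∈ schreier A α, (∀ g ∈ G, N ≤ g) → FiniteEllOneEstimate p x c ((F ∪ G).image ρ)) :
    α ≤ IsWellFounded.rank (Extends p x c) (F.image ρ) := by
  induction α using Ordinal.limitRecOn generalizing F N with
  | zero => exact zero_le
  | add_one α ih =>
    have hα' := (lt_add_one α).trans hα
    set m := max N 1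
    have h1 : Extends p x c ((insert m F).image ρ) (F.image ρ) := by
      refine ⟨?_, ρ m, hρ0 m, Finset.image_insert _ _ _, ?_⟩
      · have := h {m} (schreier_card_le_one hα (by simp)) (by simp [m])
        rwa [Finset.union_comm, ← Finset.insert_eq] at this
      · intro r' hr'
        obtain ⟨i, hi, rfl⟩ := Finset.mem_image.1 hr'
        exact hρ i m (lt_of_lt_of_le (hFN i hi) (le_max_left _ _))
    have h2 := ih hα' (insert m F) (m + 1) (fun i hi => ?_) fun G hG hg => ?_
    · exact Order.add_one_le_of_lt (h2.trans_lt (IsWellFounded.rank_lt_of_rel h1))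
    · rcases Finset.mem_insert.1 hi with rfl | hi
      · omega
      · have := hFN i hi
        omega
    · rw [Finset.insert_union, ← Finset.union_insert]
      refine h _ (insert_mem_schreier_add_one hα' (le_max_right _ _) hG hg) fun g hg' => ?_
      rcases Finset.mem_insert.1 hg' with rfl | hg'
      · exact le_max_left _ _
      · have := hg g hg'
        omega
  | limit α hlim ih =>
    refine le_of_forall_lt fun β hβ => ?_
    have hβ' := hlim.add_one_lt hβ
    obtain ⟨k, hk⟩ := schreier_eventually_subset (A := A) hα hβ'.le
    refine lt_of_lt_of_le (lt_add_one β) (ih _ hβ' (hβ'.trans hα) F (max N k)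
      (fun i hi => (hFN i hi).trans_le (le_max_left _ _)) fun G hG hg => ?_)
    exact h G (hk G hG fun i hi => (le_max_right _ _).trans (hg i hi))
      fun i hi => (le_max_left _ _).trans (hg i hi)

/-- If block bases of `x` satisfy lower `𝒮_α`-estimates uniformly in `α < ω₁`, then some block basis
of `x` is equivalent to the unit vector basis of `ℓ₁`. -/
theorem exists_ellOneEstimate_of_uniform {A : LimitSequences} (hx : Nondegenerate p x) (hc : 0 < c)
    (h : ∀ α < ω₁, ∃ y, IsBlockBasis x y ∧ LowerEstimate (schreier A α) p y c) :
    ∃ y, IsBlockBasis x y ∧ EllOneEstimate p y (c / 2) := by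
  refine exists_ellOneEstimate_of_not_wellFounded fun hwf => ?_
  have : IsWellFounded _ (Extends p x (c / 2)) := ⟨hwf⟩
  -- An index just above the rank of the root, to contradict the lower bound on that rank.
  set α := Order.succ (IsWellFounded.rank (Extends p x (c / 2)) ∅) with hαdef
  have hα : α < ω₁ := succ_lt_omega_one (rank_lt_omega_one _ _)
  obtain ⟨w, hw, hest⟩ := h α hα
  have hwn := hx.block hw
  have hc1 : c ≤ 1 := hest.le_one hwn (schreier_card_le_one hα (by simp))
  obtain ⟨d, hd, hwd⟩ := hw
  have hex : ∀ i, ∃ r : ℕ →₀ ℚ, r.support ⊆ (d i).support ∧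
      p (rationalVector x r - w i) ≤ c / 4 * p (w i) := fun i => by
    rw [hwd i]
    exact exists_rationalVector_near p x (d i) (mul_pos (by linarith) (hwd i ▸ hwn.pos i))
  choose ρ hρ1 hρ2 using hex
  have hρ0 : ∀ i, ρ i ≠ 0 := by
    intro i h0
    have h1 := hρ2 i
    have h2 := hwn.pos i
    have h3 : rationalVector x 0 = 0 := by simp [rationalVector]
    rw [h0, h3, _root_.zero_sub, map_neg_eq_map] at h1
    nlinarith
  have hρlt : ∀ i j, i < j → ∀ a ∈ (ρ i).support, ∀ b ∈ (ρ j).support, a < b :=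
    fun i j hij a ha b hb => hd.2 i j hij a (hρ1 i ha) b (hρ1 j hb)
  have hinj : Function.Injective ρ := by
    intro i j hij
    obtain ⟨a, ha⟩ := Finsupp.support_nonempty_iff.2 (hρ0 i)
    exact hd.eq_of_mem (hρ1 i ha) (hρ1 j (hij ▸ ha))
  have hle := le_rank_of_schreier (A := A) (p := p) (x := x) (c := c / 2) hρ0 hρlt hα ∅ 0
    (by simp) fun G hG _ a => ?_
  · rw [Finset.image_empty] at hle
    exact absurd (Order.lt_succ (IsWellFounded.rank (Extends p x (c / 2)) ∅)) (not_lt.2 hle)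
  rw [Finset.empty_union, Finset.sum_image hinj.injOn, Finset.sum_image hinj.injOn]
  have h1 := hest.sum_le hc.le hG fun i => a (ρ i)
  set T := ∑ i ∈ G, |a (ρ i)| * p (w i) with hT
  have h2 : p (∑ i ∈ G, a (ρ i) • w i) ≤ p (∑ i ∈ G, a (ρ i) • rationalVector x (ρ i)) +
      c / 4 * T := by
    have e1 : ∑ i ∈ G, a (ρ i) • w i = ∑ i ∈ G, a (ρ i) • rationalVector x (ρ i) -
        ∑ i ∈ G, a (ρ i) • (rationalVector x (ρ i) - w i) := by
      rw [← Finset.sum_sub_distrib]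
      simp [smul_sub]
    rw [e1]
    refine (map_sub_le_add p _ _).trans (add_le_add_right ?_ _)
    rw [hT, Finset.mul_sum]
    refine (seminorm_sum_le p _ _).trans (Finset.sum_le_sum fun i _ => ?_)
    rw [map_smul_eq_mul, Real.norm_eq_abs]
    calc |a (ρ i)| * p (rationalVector x (ρ i) - w i) ≤ |a (ρ i)| * (c / 4 * p (w i)) :=
          mul_le_mul_of_nonneg_left (hρ2 i) (abs_nonneg _)
      _ = _ := by ring
  have h3 : ∑ i ∈ G, |a (ρ i)| * p (rationalVector x (ρ i)) ≤ 3 / 2 * T := by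
    rw [hT, Finset.mul_sum]
    refine Finset.sum_le_sum fun i _ => ?_
    have e1 : p (rationalVector x (ρ i)) ≤ 3 / 2 * p (w i) := by
      have e2 := map_add_le_add p (rationalVector x (ρ i) - w i) (w i)
      rw [sub_add_cancel] at e2
      have e3 := hρ2 i
      have e4 := hwn.pos i
      nlinarith
    calc |a (ρ i)| * p (rationalVector x (ρ i)) ≤ |a (ρ i)| * (3 / 2 * p (w i)) :=
          mul_le_mul_of_nonneg_left e1 (abs_nonneg _)
      _ = _ := by ring
  -- The perturbed sum is at least `cT - (c/4)T = (c/2)(3/2)T`, which explains the accuracy `c/4`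
  -- and the final constant `c/2`.
  nlinarith

end

section
variable {E : Type*} [NormedAddCommGroup E] [NormedSpace ℝ E]
variable {ℱ 𝒢 : Set (Finset ℕ)} {p : Seminorm ℝ E} {x y : ℕ → E} {c : ℝ}

/-! ### Existence of stabilizing block bases -/

theorem singleton_zero_mem_schreier (hα : α < ω₁) : {0} ∈ schreier A α :=
  schreier_card_le_one hα (by simp)

/-- Shifting by `k` turns every set of `𝒮_α` into a set of `𝒮_β`; this `k` depends neither on the
norm nor on the sequence. -/
theorem exists_delta_schreier_le_tail (hβ : β < ω₁) (hαβ : α ≤ β) :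
    ∃ k : ℕ, ∀ (p : Seminorm ℝ E) (x : ℕ → E), Nondegenerate p x →
      delta (schreier A β) p x ≤ delta (schreier A α) p fun i => x (k + i) := by
  obtain ⟨k, hk⟩ := schreier_eventually_subset (A := A) hβ hαβ
  refine ⟨k, fun p x hx => ?_⟩
  refine LowerEstimate.le_delta (hx.block (isBlockBasis_tail x k))
    (singleton_zero_mem_schreier (hαβ.trans_lt hβ)) delta_nonneg ?_
  have hmono : StrictMono fun i => k + i := fun _ _ h => by simpa using h
  refine lowerEstimate_delta.subsequence hmono fun F hF => hk _ ?_ ?_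
  · exact schreier_spreading (hαβ.trans_lt hβ) F hF _ (hmono.strictMonoOn _) fun i _ => by omega
  · intro i hi
    obtain ⟨j, -, rfl⟩ := Finset.mem_image.1 hi
    omega

theorem deltaDot_schreier_antitone (hx : Nondegenerate p x) (hβ : β < ω₁) (hαβ : α ≤ β) :
    deltaDot (schreier A β) p x ≤ deltaDot (schreier A α) p x := by
  obtain ⟨k, hk⟩ := exists_delta_schreier_le_tail (E := E) (A := A) hβ hαβ
  exact deltaDot_le fun y hy => (hk p y (hx.block hy)).trans
    (delta_le_deltaDot hx (singleton_zero_mem_schreier (hαβ.trans_lt hβ))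
      (hy.trans (isBlockBasis_tail y k)))

/-- Since `deltaDot` decreases in `α`, the comparison with `q` is encoded by the first ordinal where
it drops below `q`. This ordinal can only decrease along block bases, so a block basis attaining its
minimum settles the comparison for all `α` simultaneously. -/
theorem exists_le_deltaDot_iff (hx : Nondegenerate p x) (q : ℝ) :
    ∃ y, IsBlockBasis x y ∧ ∀ z, IsBlockBasis y z → ∀ α < ω₁,
      (q ≤ deltaDot (schreier A α) p z ↔ q ≤ deltaDot (schreier A α) p y) := by
  -- Ordinals from `ω₁` on belong to `S y` vacuously, so the infimum is always taken over a nonempty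
  -- set.
  let S : (ℕ → E) → Set Ordinal.{0} := fun y => {α | α < ω₁ → deltaDot (schreier A α) p y < q}
  have hS : ∀ y, (S y).Nonempty := fun y => ⟨ω₁, fun h => absurd h (lt_irrefl _)⟩
  have hiff : ∀ y, IsBlockBasis x y → ∀ α < ω₁,
      (q ≤ deltaDot (schreier A α) p y ↔ α < sInf (S y)) := by
    intro y hy α hα
    constructor
    · intro h
      by_contra! hcon
      have h1 := csInf_mem (hS y) (hcon.trans_lt hα)
      have h2 := deltaDot_schreier_antitone (A := A) (hx.block hy) hα hcon
      linarith
    · intro h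
      by_contra! hcon
      exact notMem_of_lt_csInf' h fun _ => hcon
  obtain ⟨o, ⟨y, hy, rfl⟩, hmin⟩ := WellFounded.has_min (wellFounded_lt (α := Ordinal.{0}))
    {o | ∃ y, IsBlockBasis x y ∧ o = sInf (S y)} ⟨_, x, isBlockBasis_refl x, rfl⟩
  refine ⟨y, hy, fun z hz α hα => ?_⟩
  have h1 : sInf (S z) = sInf (S y) := by
    refine le_antisymm (csInf_le_csInf' (hS y) fun α h hα => ?_)
      (not_lt.1 (hmin _ ⟨z, hy.trans hz, rfl⟩))
    exact (deltaDot_anti (hx.block hy) (singleton_zero_mem_schreier hα) hz).trans_lt (h hα)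
  rw [hiff z (hy.trans hz) α hα, hiff y hy α hα, h1]

/-- Some block basis has the same constants `δ̇_α` as all its block bases, for all `α < ω₁`. -/
theorem exists_deltaDot_eq (hx : Nondegenerate p x) :
    ∃ y, IsBlockBasis x y ∧ ∀ z, IsBlockBasis y z → ∀ α < ω₁,
      deltaDot (schreier A α) p z = deltaDot (schreier A α) p y := by
  obtain ⟨q, hq⟩ := exists_surjective_nat ℚ
  obtain ⟨y, hy, h⟩ := exists_isBlockBasis_diagonal (x := x)
    (P := fun n y => ∀ z, IsBlockBasis y z → ∀ α < ω₁,
      ((q n : ℝ) ≤ deltaDot (schreier A α) p z ↔ (q n : ℝ) ≤ deltaDot (schreier A α) p y))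
    fun n y hy => exists_le_deltaDot_iff (hx.block hy) _
  have key : ∀ z, IsBlockBasis y z → ∀ α < ω₁, ∀ r : ℚ,
      ((r : ℝ) ≤ deltaDot (schreier A α) p z ↔ (r : ℝ) ≤ deltaDot (schreier A α) p y) := by
    intro z hz α hα r
    obtain ⟨n, rfl⟩ := hq r
    obtain ⟨v, -, hv, hvy⟩ := h n
    have h0 := singleton_zero_mem_schreier (A := A) hα
    have hs := schreier_spreading (A := A) hα
    -- The property of `v` is available only for block bases of `v`, such as tails of `y` and `z`;
    -- `deltaDot` does not see the removed initial terms.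
    rw [← deltaDot_tail (hx.block (hy.trans hz)) h0 hs n, ← deltaDot_tail (hx.block hy) h0 hs n,
      hv _ (hvy.trans (hz.tail n)) α hα, hv _ hvy α hα]
  exact ⟨y, hy, fun z hz α hα => le_antisymm
    (le_of_forall_rat_lt_imp_le fun r hr => (key z hz α hα r).1 hr.le)
    (le_of_forall_rat_lt_imp_le fun r hr => (key z hz α hα r).2 hr.le)⟩

theorem tendsto_one_div_add_one : Tendsto (fun n : ℕ => 1 / ((n : ℝ) + 1)) atTop (𝓝 0) :=
  tendsto_one_div_add_atTop_nhds_zero_nat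

theorem antitone_one_div_add_one : Antitone fun n : ℕ => 1 / ((n : ℝ) + 1) := fun m n h =>
  one_div_le_one_div_of_le (by positivity) (by simpa using h)

theorem EllOneEstimate.exists_stabilizes (hx : Nondegenerate p x) (hc : 0 < c)
    (h : EllOneEstimate p x c) :
    ∃ y, IsBlockBasis x y ∧ Stabilizes A p y fun _ => 1 := by
  obtain ⟨y, hy, hP⟩ := exists_isBlockBasis_diagonal (x := x)
    -- The shift by `2` keeps James's parameter below `1` already at `n = 0` and leaves strict room
    -- below `1 / (n + 1)`.
    (P := fun n z => EllOneEstimate p z (1 - 1 / ((n : ℝ) + 2))) fun n z hz => by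
      refine (h.block hc.le hz).exists_improvement (hx.block hz) hc (by positivity) ?_
      rw [div_lt_one (by positivity)]
      have := Nat.cast_nonneg (α := ℝ) n
      linarith
  refine ⟨y, hy, _, antitone_one_div_add_one, tendsto_one_div_add_one, fun α => ⟨0, ?_⟩⟩
  intro n _ w hw
  obtain ⟨v, -, hv, hvy⟩ := hP n
  have hwn : Nondegenerate p w := hx.block (hy.trans ((isBlockBasis_tail y n).trans hw))
  have h0 := singleton_zero_mem_schreier (A := A) α.2
  have hn : (0 : ℝ) ≤ n := Nat.cast_nonneg n
  have h2 : 1 / ((n : ℝ) + 2) < 1 / ((n : ℝ) + 1) :=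
    one_div_lt_one_div_of_lt (by positivity) (by linarith)
  have h3 : (0 : ℝ) ≤ 1 - 1 / ((n : ℝ) + 2) := by
    rw [sub_nonneg, div_le_one (by positivity)]
    linarith
  have h1 : 1 - 1 / ((n : ℝ) + 2) ≤ delta (schreier A α) p w :=
    LowerEstimate.le_delta hwn h0 h3 ((hv.block h3 (hvy.trans hw)).lowerEstimate h3)
  have h4 := delta_le_one hwn h0
  rw [abs_lt]
  constructor <;> linarith [show (0 : ℝ) < 1 / ((n : ℝ) + 1) by positivity]

theorem countable_Iic_of_lt_omega_one (hβ : β < ω₁) : (Set.Iic β).Countable := by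
  have h1 : Set.Iic β = Set.Iio (Order.succ β) := by
    ext
    simp
  have h2 := Cardinal.lt_omega_iff_card_lt.1 (succ_lt_omega_one hβ)
  rw [← Cardinal.succ_aleph0, Order.lt_succ_iff] at h2
  rw [h1, ← Cardinal.le_aleph0_iff_set_countable, Cardinal.mk_Iio_ordinal]
  exact Cardinal.lift_le_aleph0.2 h2

/-- Otherwise ordinals `α_n` with `g α_n < 1/(n+1)` would have a supremum below `ω₁`, at which `g`
could not be positive. -/
theorem exists_pos_le_of_antitone {g : Ordinal.{0} → ℝ}
    (hg : ∀ α β, α ≤ β → β < ω₁ → g β ≤ g α) (hpos : ∀ α < ω₁, 0 < g α) :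
    ∃ c, 0 < c ∧ ∀ α < ω₁, c ≤ g α := by
  by_contra! hcon
  have h1 : ∀ n : ℕ, ∃ α < ω₁, g α < 1 / ((n : ℝ) + 1) := fun n => hcon _ (by positivity)
  choose α hα hlt using h1
  have hβ : ⨆ n, α n < ω₁ := Ordinal.iSup_lt_omega_one hα
  obtain ⟨n, hn⟩ := exists_nat_one_div_lt (hpos _ hβ)
  have h2 := hg (α n) _ (Ordinal.le_iSup α n) hβ
  linarith [hlt n]

/-- The indices are treated one by one: an inequality already achieved survives further block bases,
and constancy of `deltaDot` makes the next one achievable. -/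
theorem exists_isBlockBasis_lt_delta (hx : Nondegenerate p x)
    (hconst : ∀ y, IsBlockBasis x y → ∀ α < ω₁,
      deltaDot (schreier A α) p y = deltaDot (schreier A α) p x)
    {s : ℕ → Ordinal.{0}} (hs : ∀ j, s j < ω₁) {ε : ℝ} (hε : 0 < ε) (n : ℕ)
    (hxy : IsBlockBasis x y) :
    ∃ z, IsBlockBasis y z ∧ ∀ j < n,
      deltaDot (schreier A (s j)) p x - ε < delta (schreier A (s j)) p z := by
  induction n with
  | zero => exact ⟨y, isBlockBasis_refl y, fun j hj => by omega⟩
  | succ n ih =>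
    obtain ⟨z, hz, h⟩ := ih
    obtain ⟨w, hw, hlt⟩ := exists_lt_delta
      (show deltaDot (schreier A (s n)) p x - ε < deltaDot (schreier A (s n)) p z by
        rw [hconst z (hxy.trans hz) _ (hs n)]
        linarith)
    refine ⟨w, hz.trans hw, fun j hj => ?_⟩
    rcases Nat.lt_succ_iff_lt_or_eq.1 hj with hj | rfl
    · exact (h j hj).trans_le (delta_le_of_isBlockBasis (hx.block (hxy.trans hz))
        (singleton_zero_mem_schreier (hs j)) (schreier_spreading (hs j)) hw)
    · exact hlt

/-- Every nondegenerate sequence has a block basis that `Δ`-stabilizes some family. -/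
theorem exists_stabilizes (A : LimitSequences) (hx : Nondegenerate p x) :
    ∃ y, IsBlockBasis x y ∧ ∃ γ, Stabilizes A p y γ := by
  obtain ⟨y, hy, hconst⟩ := exists_deltaDot_eq (A := A) hx
  have hyn := hx.block hy
  have hanti := fun (α β : Ordinal.{0}) (h : α ≤ β) (hβ : β < ω₁) =>
    deltaDot_schreier_antitone (A := A) hyn hβ h
  by_cases hzero : ∃ β < ω₁, deltaDot (schreier A β) p y = 0
  · obtain ⟨β, hβ, hβ0⟩ := hzero
    obtain ⟨s, hs⟩ := (countable_Iic_of_lt_omega_one hβ).exists_eq_range ⟨β, mem_Iic.2 le_rfl⟩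
    have hsβ : ∀ j, s j ≤ β := fun j => by
      have : s j ∈ Set.Iic β := hs ▸ mem_range_self j
      exact this
    obtain ⟨z, hz, hP⟩ := exists_isBlockBasis_diagonal (x := y)
      (P := fun n z => ∀ j < n + 1, deltaDot (schreier A (s j)) p y - 1 / ((n : ℝ) + 1) <
        delta (schreier A (s j)) p z) fun n v hv =>
        exists_isBlockBasis_lt_delta hyn hconst (fun j => (hsβ j).trans_lt hβ) (by positivity) _ hv
    refine ⟨z, hy.trans hz, fun α => deltaDot (schreier A α) p y, _, antitone_one_div_add_one,
      tendsto_one_div_add_one, fun α => ?_⟩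
    have hup : ∀ n w, IsBlockBasis (fun i => z (n + i)) w →
        delta (schreier A α) p w ≤ deltaDot (schreier A α) p y := fun n w hw =>
      delta_le_deltaDot hyn (singleton_zero_mem_schreier α.2)
        (hz.trans ((isBlockBasis_tail z n).trans hw))
    rcases le_or_gt (α : Ordinal) β with hα | hα
    · obtain ⟨j, hj⟩ : (α : Ordinal) ∈ range s := hs ▸ hα
      refine ⟨j, fun n hn w hw => ?_⟩
      obtain ⟨v, hv, hvP, hvz⟩ := hP n
      have h1 := hvP j (by omega)
      rw [hj] at h1
      have h2 := delta_le_of_isBlockBasis (hyn.block hv) (singleton_zero_mem_schreier α.2)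
        (schreier_spreading (A := A) α.2) (hvz.trans hw)
      have h3 := hup n w hw
      rw [abs_lt]
      constructor <;> linarith [show (0 : ℝ) < 1 / ((n : ℝ) + 1) by positivity]
    -- Beyond `β` both `delta` and `deltaDot` are zero, so no `m` has to be chosen.
    · refine ⟨0, fun n _ w hw => ?_⟩
      have h1 := hup n w hw
      have h2 := hanti β α hα.le α.2
      have h3 : 0 ≤ delta (schreier A α) p w := delta_nonneg
      rw [abs_lt]
      constructor <;> linarith [show (0 : ℝ) < 1 / ((n : ℝ) + 1) by positivity]
  -- All constants are positive, hence uniformly so: this is the `ℓ₁` case.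
  · push Not at hzero
    obtain ⟨c, hc, hle⟩ := exists_pos_le_of_antitone hanti
      fun α hα => lt_of_le_of_ne deltaDot_nonneg (hzero α hα).symm
    obtain ⟨b, hb, hest⟩ := exists_ellOneEstimate_of_uniform (A := A) hyn (half_pos hc)
      fun α hα => by
        obtain ⟨w, hw, hlt⟩ := exists_lt_delta ((half_lt_self hc).trans_le (hle α hα))
        exact ⟨w, hw, lowerEstimate_delta.mono hlt.le⟩
    obtain ⟨z, hz, hst⟩ := hest.exists_stabilizes (A := A) (hyn.block hb) (half_pos (half_pos hc))
    exact ⟨z, hy.trans (hb.trans hz), _, hst⟩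

end

section
variable {E : Type*} [NormedAddCommGroup E] [NormedSpace ℝ E]
variable {ℱ 𝒢 : Set (Finset ℕ)} {p : Seminorm ℝ E} {x y : ℕ → E} {c : ℝ}
variable {γ : CountableOrdinal → ℝ}

/-! ### Properties of stabilized families -/

theorem Stabilizes.eventually (h : Stabilizes A p x γ) (α : CountableOrdinal) {η : ℝ}
    (hη : 0 < η) : ∃ N : ℕ, ∀ n ≥ N, ∀ w, IsBlockBasis (fun i => x (n + i)) w →
      |delta (schreier A α) p w - γ α| < η := by
  obtain ⟨ε, -, hε, h⟩ := h
  obtain ⟨m, hm⟩ := h α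
  obtain ⟨k, hk⟩ := eventually_atTop.1 (hε.eventually (gt_mem_nhds hη))
  exact ⟨max m k, fun n hn w hw => (hm n ((le_max_left _ _).trans hn) w hw).trans
    (hk n ((le_max_right _ _).trans hn))⟩

theorem Stabilizes.le_of_forall_delta_le (h : Stabilizes A p x γ) {α : CountableOrdinal} {C : ℝ}
    (hC : ∀ N, delta (schreier A α) p (fun i => x (N + i)) ≤ C) : γ α ≤ C := by
  refine le_of_forall_pos_le_add fun η hη => ?_
  obtain ⟨N, hN⟩ := h.eventually α hη
  have h1 := abs_lt.1 (hN N le_rfl _ (isBlockBasis_refl _))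
  linarith [hC N, h1.1]

theorem Stabilizes.le_of_forall_le_delta (h : Stabilizes A p x γ) {α : CountableOrdinal} {C : ℝ}
    (hC : ∀ N, C ≤ delta (schreier A α) p (fun i => x (N + i))) : C ≤ γ α := by
  refine le_of_forall_pos_le_add fun η hη => ?_
  obtain ⟨N, hN⟩ := h.eventually α hη
  have h1 := abs_lt.1 (hN N le_rfl _ (isBlockBasis_refl _))
  linarith [hC N, h1.2]

theorem Stabilizes.mem_Icc (h : Stabilizes A p x γ) (hx : Nondegenerate p x)
    (α : CountableOrdinal) : γ α ∈ Icc (0 : ℝ) 1 :=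
  ⟨h.le_of_forall_le_delta fun _ => delta_nonneg, h.le_of_forall_delta_le fun N =>
    delta_le_one (hx.block (isBlockBasis_tail x N)) (singleton_zero_mem_schreier α.2)⟩

theorem Stabilizes.antitone (h : Stabilizes A p x γ) (hx : Nondegenerate p x) : Antitone γ := by
  intro α β hαβ
  refine le_of_forall_pos_le_add fun η hη => ?_
  obtain ⟨N, hN⟩ := h.eventually α (half_pos hη)
  obtain ⟨M, hM⟩ := h.eventually β (half_pos hη)
  obtain ⟨k, hk⟩ := exists_delta_schreier_le_tail (E := E) (A := A) β.2 hαβ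
  let n := max N M
  have h1 := abs_lt.1 (hN n (le_max_left _ _) _ (isBlockBasis_tail _ k))
  have h2 := abs_lt.1 (hM n (le_max_right _ _) _ (isBlockBasis_refl _))
  have h3 := hk p _ (hx.block (isBlockBasis_tail x n))
  linarith [h1.2, h2.1]

/-- Lower estimates for blocks indexed by an arbitrary finite linear order. -/
theorem LowerEstimate.finset {ι : Type*} [LinearOrder ι] {δ : ℝ} (h : LowerEstimate ℱ p x δ)
    (s : Finset ι) (c : ι → ℕ →₀ ℝ) (h0 : ∀ i ∈ s, c i ≠ 0)
    (hlt : ∀ i ∈ s, ∀ j ∈ s, i < j → ∀ a ∈ (c i).support, ∀ b ∈ (c j).support, a < b)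
    (hs : s.image (fun i => minSupp (c i)) ∈ ℱ) :
    δ * ∑ i ∈ s, p (Finsupp.linearCombination ℝ x (c i)) ≤
      p (∑ i ∈ s, Finsupp.linearCombination ℝ x (c i)) := by
  let o := s.orderEmbOfFin rfl
  have ho : ∀ i, o i ∈ s := fun i => s.orderEmbOfFin_mem rfl i
  have him : Finset.univ.image o = s := by
    ext m
    simp only [Finset.mem_image, Finset.mem_univ, true_and]
    rw [← Finset.mem_coe, ← Finset.range_orderEmbOfFin s rfl]
    rfl
  have h1 := h s.card (fun j => c (o j)) (isAdmissible_iff.2 ⟨⟨fun j => h0 _ (ho j),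
    fun i j hij => hlt _ (ho i) _ (ho j) (o.strictMono hij)⟩, ?_⟩)
  · conv_lhs => rw [← him, Finset.sum_image o.injective.injOn]
    conv_rhs => rw [← him, Finset.sum_image o.injective.injOn]
    exact h1
  · rw [← him, Finset.image_image] at hs
    exact hs

/-- Blocks whose minima lie in the same segment are added up to a block `C m` with minimum exactly
`m`. The estimate for `ℱ` separates the `C m`, and the one for `𝒢` separates the blocks inside each
of them. -/
theorem LowerEstimate.familyComp {δ₁ δ₂ : ℝ} (hδ₁ : 0 ≤ δ₁) (h₁ : LowerEstimate ℱ p x δ₁)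
    (h₂ : LowerEstimate 𝒢 p x δ₂) : LowerEstimate (familyComp ℱ 𝒢) p x (δ₁ * δ₂) := by
  intro k c hc
  obtain ⟨hc, hH⟩ := isAdmissible_iff.1 hc
  set H := Finset.univ.image fun i => minSupp (c i)
  obtain ⟨M, hM, hMH, hle, hseg⟩ := mem_familyComp_iff.1 hH
  let J : ℕ → Finset (Fin k) := fun m => {j | minSupp (c j) ∈ segment M H m}
  have hJ : ∀ m j, j ∈ J m ↔ minSupp (c j) ∈ segment M H m := fun m j => by simp [J]
  let C : ℕ → ℕ →₀ ℝ := fun m => ∑ j ∈ J m, c j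
  have hCs : ∀ m, ∀ a ∈ (C m).support, ∃ j ∈ J m, a ∈ (c j).support := fun m a ha => by
    simpa using Finsupp.support_finsetSum ha
  have hCm : ∀ m ∈ M, m ∈ (C m).support := by
    intro m hm
    obtain ⟨j, -, hj⟩ := Finset.mem_image.1 (hMH hm)
    have hmj : m ∈ (c j).support := hj ▸ minSupp_mem (hc.1 j)
    have hjJ : j ∈ J m := by
      rw [hJ, hj]
      exact mem_segment.2 ⟨hMH hm, le_rfl, fun _ _ h => h⟩
    rw [Finsupp.mem_support_iff, Finsupp.finsetSum_apply, Finset.sum_eq_single_of_mem j hjJ]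
    · exact Finsupp.mem_support_iff.1 hmj
    · intro i _ hij
      by_contra hcon
      exact hij (hc.eq_of_mem (Finsupp.mem_support_iff.2 hcon) hmj)
  have hCmin : ∀ m ∈ M, minSupp (C m) = m := fun m hm => minSupp_eq (hCm m hm) fun a ha => by
    obtain ⟨j, hj, haj⟩ := hCs m a ha
    exact (mem_segment.1 ((hJ m j).1 hj)).2.1.trans (minSupp_le haj)
  have hinner : ∀ m ∈ M, δ₂ * ∑ j ∈ J m, p (Finsupp.linearCombination ℝ x (c j)) ≤
      p (Finsupp.linearCombination ℝ x (C m)) := by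
    intro m hm
    rw [map_sum (Finsupp.linearCombination ℝ x)]
    refine h₂.finset _ _ (fun i _ => hc.1 i) (fun i _ j _ => hc.2 i j) ?_
    convert hseg m hm using 1
    ext a
    rw [Finset.mem_image]
    constructor
    · rintro ⟨j, hj, rfl⟩
      exact (hJ m j).1 hj
    · intro ha
      obtain ⟨j, -, hj⟩ := Finset.mem_image.1 (mem_segment.1 ha).1
      exact ⟨j, (hJ m j).2 (hj ▸ ha), hj⟩
  have houter : δ₁ * ∑ m ∈ M, p (Finsupp.linearCombination ℝ x (C m)) ≤
      p (∑ m ∈ M, Finsupp.linearCombination ℝ x (C m)) := by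
    refine h₁.finset M C (fun m hm h0 => by simpa [h0] using hCm m hm) ?_ ?_
    · intro m hm m' hm' hlt a ha b hb
      obtain ⟨i, hi, hai⟩ := hCs m a ha
      obtain ⟨j, hj, hbj⟩ := hCs m' b hb
      have h1 := (mem_segment.1 ((hJ m i).1 hi)).2.2 m' hm' hlt
      have h2 := (mem_segment.1 ((hJ m' j).1 hj)).2.1
      exact hc.2 i j (hc.minSupp_strictMono.lt_iff_lt.1 (h1.trans_le h2)) a hai b hbj
    · convert hM
      ext a
      rw [Finset.mem_image]
      exact ⟨fun ⟨m, hm, h⟩ => by rwa [← h, hCmin m hm], fun h => ⟨a, h, hCmin a h⟩⟩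
  have huniv : (Finset.univ : Finset (Fin k)) = M.biUnion J := by
    ext j
    have hj : minSupp (c j) ∈ H := Finset.mem_image_of_mem _ (Finset.mem_univ j)
    obtain ⟨m, hm, h⟩ := exists_mem_segment hj (hle _ hj)
    simp only [Finset.mem_univ, Finset.mem_biUnion, true_iff]
    exact ⟨m, hm, (hJ m j).2 h⟩
  have hdisj : Set.PairwiseDisjoint (M : Set ℕ) J := fun m hm m' hm' hne =>
    Finset.disjoint_left.2 fun j hj hj' =>
      hne (eq_of_mem_segment hm hm' ((hJ m j).1 hj) ((hJ m' j).1 hj'))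
  rw [huniv, Finset.sum_biUnion hdisj, Finset.sum_biUnion hdisj, mul_assoc]
  refine (mul_le_mul_of_nonneg_left ?_ hδ₁).trans (houter.trans_eq ?_)
  · rw [Finset.mul_sum]
    exact Finset.sum_le_sum hinner
  · exact congrArg p (Finset.sum_congr rfl fun m _ => map_sum (Finsupp.linearCombination ℝ x) _ _)

theorem exists_strictMono_ge (M : ℕ → ℕ) : ∃ φ : ℕ → ℕ, StrictMono φ ∧ ∀ i, M i ≤ φ i := by
  refine ⟨fun i => i + ∑ j ∈ Finset.range (i + 1), M j, strictMono_nat_of_lt_succ fun i => ?_,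
    fun i => ?_⟩
  · rw [Finset.sum_range_succ _ (i + 1)]
    omega
  · simp only
    rw [Finset.sum_range_succ]
    omega

/-- On a late tail `u`, where all three constants are nearly stable, a sparse subsequence sends sets
of `𝒮_{β+α}` into `𝒮_α[𝒮_β]`, where the two estimates multiply. -/
theorem Stabilizes.mul_le (h : Stabilizes A p x γ) (hx : Nondegenerate p x)
    (α β : CountableOrdinal) : γ α * γ β ≤ γ ⟨(β : Ordinal) + α, add_lt_omega_one β.2 α.2⟩ := by
  set σ : CountableOrdinal := ⟨(β : Ordinal) + α, add_lt_omega_one β.2 α.2⟩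
  refine le_of_forall_pos_le_add fun η' hη' => ?_
  -- The bound `1` controls the `η²` term: the product costs `3η`, and the stabilization at `β + α`
  -- one more.
  set η := min (η' / 4) 1
  have hη : 0 < η := lt_min (by linarith) one_pos
  have hη1 : η ≤ 1 := min_le_right _ _
  have hη2 : 4 * η ≤ η' := by linarith [min_le_left (η' / 4) 1]
  obtain ⟨N₁, hN₁⟩ := h.eventually α hη
  obtain ⟨N₂, hN₂⟩ := h.eventually β hη
  obtain ⟨N₃, hN₃⟩ := h.eventually σ hη
  let N := max N₁ (max N₂ N₃)
  obtain ⟨M, hM⟩ := exists_image_mem_familyComp (A := A) β.2 α.2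
  obtain ⟨φ, hφ, hMφ⟩ := exists_strictMono_ge M
  have hxN := hx.block (isBlockBasis_tail x N)
  set u : ℕ → E := fun i => x (N + i)
  have h1 := abs_lt.1 (hN₁ N (le_max_left _ _) u (isBlockBasis_refl _))
  have h2 := abs_lt.1 (hN₂ N ((le_max_left _ _).trans (le_max_right _ _)) u (isBlockBasis_refl _))
  have h3 := abs_lt.1 (hN₃ N ((le_max_right _ _).trans (le_max_right _ _)) _
    (isBlockBasis_comp u hφ))
  have h4 : delta (schreier A α) p u * delta (schreier A β) p u ≤
      delta (schreier A σ) p fun i => u (φ i) := by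
    refine LowerEstimate.le_delta (hxN.block (isBlockBasis_comp u hφ))
      (singleton_zero_mem_schreier σ.2) (mul_nonneg delta_nonneg delta_nonneg) ?_
    exact (lowerEstimate_delta.familyComp delta_nonneg lowerEstimate_delta).subsequence hφ
      fun F hF => hM F hF φ (hφ.strictMonoOn _) fun i _ => hMφ i
  have ha := h.mem_Icc hx α
  have hb := h.mem_Icc hx β
  have d1 : delta (schreier A α) p u ≤ 1 := delta_le_one hxN (singleton_zero_mem_schreier α.2)
  have d2 : delta (schreier A β) p u ≤ 1 := delta_le_one hxN (singleton_zero_mem_schreier β.2)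
  have d3 : 0 ≤ delta (schreier A α) p u := delta_nonneg
  have d4 : 0 ≤ delta (schreier A β) p u := delta_nonneg
  have h5 : γ α * γ β ≤ (delta (schreier A α) p u + η) * (delta (schreier A β) p u + η) :=
    mul_le_mul (by linarith [h1.1]) (by linarith [h2.1]) hb.1 (by linarith)
  have h6 : (delta (schreier A α) p u + η) * (delta (schreier A β) p u + η) ≤
      delta (schreier A α) p u * delta (schreier A β) p u + 3 * η := by nlinarith
  linarith [h3.2]

theorem Stabilizes.pow_le (h : Stabilizes A p x γ) (hx : Nondegenerate p x) (α : CountableOrdinal)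
    {n : ℕ} (hn : 1 ≤ n) : γ α ^ n ≤ γ ⟨(α : Ordinal) * n, mul_nat_lt_omega_one α.2 n⟩ := by
  induction n, hn using Nat.le_induction with
  | base => simp
  | succ n _ ih =>
    have h1 := h.mul_le hx α ⟨(α : Ordinal) * n, mul_nat_lt_omega_one α.2 n⟩
    have h2 : (⟨(α : Ordinal) * (n + 1 : ℕ), mul_nat_lt_omega_one α.2 (n + 1)⟩ :
        CountableOrdinal) = ⟨(α : Ordinal) * n + α,
          add_lt_omega_one (mul_nat_lt_omega_one α.2 n) α.2⟩ := by
      refine Subtype.ext ?_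
      simp [mul_add]
    rw [h2, pow_succ']
    exact (mul_le_mul_of_nonneg_left ih (h.mem_Icc hx α).1).trans h1

theorem linearCombination_congr {c : ℕ →₀ ℝ} (h : ∀ i ∈ c.support, x i = y i) :
    Finsupp.linearCombination ℝ x c = Finsupp.linearCombination ℝ y c := by
  rw [Finsupp.linearCombination_apply, Finsupp.linearCombination_apply]
  exact Finset.sum_congr rfl fun i hi => congrArg (c i • ·) (h i hi)

/-- A subsequence `x_{j + h(j)}` can be changed before `n` so that it becomes a subsequence of
`(x_i)_{i ≥ h(n)}`. -/
theorem isBlockBasis_modified {h : ℕ → ℕ} (hh : Monotone h) (x : ℕ → E) (n : ℕ) :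
    IsBlockBasis (fun i => x (h n + i)) fun j => x (j + h (max j n)) := by
  have hle : ∀ j, h n ≤ h (max j n) := fun j => hh (le_max_right _ _)
  have h1 : (fun j => x (j + h (max j n))) =
      fun j => (fun i => x (h n + i)) (j + (h (max j n) - h n)) := by
    funext j
    have := hle j
    simp only
    congr 1
    omega
  rw [h1]
  refine isBlockBasis_comp _ (φ := fun j => j + (h (max j n) - h n)) fun i j hij => ?_
  have h2 := hh (max_le_max_right n hij.le)
  have h3 := hle i
  simp only
  omega

theorem exists_monotone_ge (M : ℕ → ℕ) : ∃ h : ℕ → ℕ, Monotone h ∧ ∀ i, M i ≤ h i := by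
  obtain ⟨h, hh, hM⟩ := exists_strictMono_ge M
  exact ⟨h, hh.monotone, hM⟩

/-- A set of `𝒮_α` lies in some `𝒮_{α_n}` and starts at `n` or later. There `y` agrees with a
subsequence `w` of the tail from `f n`, far enough out for the estimate at `α_n` to hold. So the
single sequence `y` satisfies the estimate for `𝒮_α`. -/
theorem Stabilizes.le_of_limit (h : Stabilizes A p x γ) (hx : Nondegenerate p x)
    {α : CountableOrdinal} (hα : Order.IsSuccLimit (α : Ordinal)) {C : ℝ}
    (hC : ∀ n, C ≤ γ ⟨A.seq α n, (A.lt α hα α.2 n).trans α.2⟩) : C ≤ γ α := by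
  refine le_of_forall_pos_le_add fun η hη => ?_
  have hlt : ∀ n, A.seq α n < ω₁ := fun n => (A.lt α hα α.2 n).trans α.2
  choose N hN using fun n => h.eventually ⟨A.seq α n, hlt n⟩ (half_pos hη)
  obtain ⟨N', hN'⟩ := h.eventually α (half_pos hη)
  obtain ⟨f, hf, hfN⟩ := exists_monotone_ge fun n => max (N n) N'
  let y : ℕ → E := fun j => x (j + f j)
  have hy : IsBlockBasis (fun i => x (f 0 + i)) y := by
    simpa using isBlockBasis_modified hf x 0
  have hyn : Nondegenerate p y := hx.block ((isBlockBasis_tail x _).trans hy)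
  have h1 := abs_lt.1 (hN' (f 0) ((le_max_right _ _).trans (hfN 0)) y hy)
  suffices hlow : C - η / 2 ≤ delta (schreier A α) p y by linarith [h1.2]
  rcases le_total (C - η / 2) 0 with hneg | hpos
  · exact hneg.trans delta_nonneg
  refine LowerEstimate.le_delta hyn (singleton_zero_mem_schreier α.2) hpos ?_
  intro k c hc
  have hcF := (isAdmissible_iff.1 hc).2
  rw [schreier_limit A hα α.2] at hcF
  obtain ⟨n, hF, hn⟩ := hcF
  have hw := isBlockBasis_modified hf x n
  set w : ℕ → E := fun j => x (j + f (max j n))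
  have heq : ∀ i, Finsupp.linearCombination ℝ y (c i) = Finsupp.linearCombination ℝ w (c i) := by
    intro i
    refine linearCombination_congr fun j hj => ?_
    have h2 := hn _ (Finset.mem_image_of_mem _ (Finset.mem_univ i))
    have h3 := minSupp_le hj
    simp only [y, w, max_eq_left (h2.trans h3)]
  have h4 := abs_lt.1 (hN n (f n) ((le_max_left _ _).trans (hfN n)) w hw)
  have h5 : LowerEstimate (schreier A (A.seq α n)) p w (C - η / 2) :=
    lowerEstimate_delta.mono (by linarith [h4.1, hC n])
  simp only [heq]
  exact h5 k c (isAdmissible_iff.2 ⟨(isAdmissible_iff.1 hc).1, hF⟩)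

/-- Non-limit points are isolated. At a limit, `γ` is antitone, so only a downward jump from the
left has to be excluded, and `Stabilizes.le_of_limit` does this. -/
theorem Stabilizes.continuous (h : Stabilizes A p x γ) (hx : Nondegenerate p x) :
    Continuous γ := by
  rw [continuous_iff_continuousAt]
  intro α
  have hanti := h.antitone hx
  refine Metric.tendsto_nhds.2 fun ε hε => ?_
  by_cases hα : Order.IsSuccLimit (α : Ordinal)
  · obtain ⟨n, hn⟩ : ∃ n, γ ⟨A.seq α n, (A.lt α hα α.2 n).trans α.2⟩ < γ α + ε := by
      by_contra! hcon
      linarith [h.le_of_limit hx hα hcon]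
    have hmem : Ioo (A.seq α n) (Order.succ (α : Ordinal)) ∈ 𝓝 (α : Ordinal) :=
      isOpen_Ioo.mem_nhds ⟨A.lt α hα α.2 n, Order.lt_succ _⟩
    filter_upwards [continuous_subtype_val.continuousAt.preimage_mem_nhds hmem] with a ha
    have h1 : γ α ≤ γ a := hanti (show (a : Ordinal) ≤ α from Order.lt_succ_iff.1 ha.2)
    have h2 : γ a ≤ _ := hanti (show (⟨A.seq α n, (A.lt α hα α.2 n).trans α.2⟩ :
      CountableOrdinal) ≤ a from ha.1.le)
    rw [Real.dist_eq, abs_lt]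
    constructor <;> linarith
  · have hmem : {(α : Ordinal)} ∈ 𝓝 (α : Ordinal) :=
      (SuccOrder.isOpen_singleton_iff.2 hα).mem_nhds rfl
    filter_upwards [continuous_subtype_val.continuousAt.preimage_mem_nhds hmem] with a ha
    have : a = α := Subtype.ext ha
    simpa [this] using hε

/-! ### `γ₁ = 1` and `ℓ₁` -/

/-- Only two-element sets of `𝒮₁` are used: one vector of a sparse subsequence is split off from
everything after it, with loss `2^{-(i+2)}`, and the process is iterated. -/
theorem Stabilizes.exists_ellOneEstimate (h : Stabilizes A p x γ)
    (h1 : γ ⟨1, one_lt_omega_one⟩ = 1) :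
    ∃ y, IsBlockBasis x y ∧ EllOneEstimate p y (1 / 2) := by
  choose N hN using fun n : ℕ => h.eventually ⟨1, one_lt_omega_one⟩
    (show (0 : ℝ) < (1 / 2) ^ (n + 2) by positivity)
  obtain ⟨f, hf, hfN⟩ := exists_monotone_ge N
  let y : ℕ → E := fun j => x (j + f j)
  -- Index `0` is excluded because it stands for the integer `1`, which cannot be the minimum of a
  -- pair in `𝒮₁`.
  have hpair : ∀ i, 1 ≤ i → ∀ (t : ℝ) (r : ℕ →₀ ℝ), t ≠ 0 → r ≠ 0 → (∀ j ∈ r.support, i < j) →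
      (1 - (1 / 2) ^ (i + 2)) * (|t| * p (y i) + p (Finsupp.linearCombination ℝ y r)) ≤
        p (t • y i + Finsupp.linearCombination ℝ y r) := by
    intro i hi t r ht hr hlt
    have hw := isBlockBasis_modified hf x i
    set w : ℕ → E := fun j => x (j + f (max j i))
    have h2 := abs_lt.1 (hN i (f i) (hfN i) w hw)
    rw [h1] at h2
    have hwi : y i = w i := by simp [y, w]
    have hwr : Finsupp.linearCombination ℝ y r = Finsupp.linearCombination ℝ w r :=
      linearCombination_congr fun j hj => by simp [y, w, max_eq_left (hlt j hj).le]
    have h3 : LowerEstimate (schreier A 1) p w (1 - (1 / 2) ^ (i + 2)) :=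
      lowerEstimate_delta.mono (by linarith [h2.1])
    have h4 := h3 2 ![Finsupp.single i t, r] (isAdmissible_iff.2 ⟨⟨?_, ?_⟩, ?_⟩)
    · simpa [Fin.sum_univ_two, hwi, hwr, map_smul_eq_mul] using h4
    · intro j
      fin_cases j <;> simp [ht, hr]
    · intro j k hjk a ha b hb
      obtain rfl : j = 0 := by omega
      obtain rfl : k = 1 := by omega
      simp only [Matrix.cons_val_zero, Matrix.cons_val_one, Finsupp.support_single _ ht,
        Finset.mem_singleton] at ha hb
      subst ha
      exact hlt b hb
    · have e1 : minSupp (Finsupp.single i t) = i :=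
        minSupp_eq (by simp [ht]) (by simp [Finsupp.support_single _ ht])
      have e2 : Finset.univ.image (fun j => minSupp (![Finsupp.single i t, r] j)) =
          insert i {minSupp r} := by
        ext a
        simp [Fin.exists_fin_two, e1, eq_comm]
      rw [e2, ← zero_add (1 : Ordinal)]
      exact insert_mem_schreier_add_one (omega_pos 1) hi
        (schreier_card_le_one (omega_pos 1) (by simp))
        (by simpa using hlt _ (minSupp_mem hr))
  have hpow : ∀ i : ℕ, (0 : ℝ) < (1 / 2) ^ (i + 2) ∧ (1 / 2 : ℝ) ^ (i + 2) ≤ 1 := fun i =>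
    ⟨by positivity, pow_le_one₀ (by norm_num) (by norm_num)⟩
  have key : ∀ (k i : ℕ), 1 ≤ i → ∀ a : ℕ →₀ ℝ, (∀ j ∈ a.support, i ≤ j ∧ j < i + k) →
      (1 - (1 / 2) ^ (i + 1)) * weight p y a ≤ p (Finsupp.linearCombination ℝ y a) := by
    intro k
    induction k with
    | zero =>
      intro i _ a ha
      have : a = 0 := by
        rw [← Finsupp.support_eq_empty, Finset.eq_empty_iff_forall_notMem]
        intro j hj
        have := ha j hj
        omega
      simp [this, weight_zero]
    | succ k ih =>
      intro i hi a ha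
      have hp := hpow i
      -- One half of the allowed loss pays for the splitting at `i`, the other for the remainder;
      -- below, `1 - 2s ≤ (1 - s)²`.
      have hsplit : (1 / 2 : ℝ) ^ (i + 1) = (1 / 2) ^ (i + 2) + (1 / 2) ^ (i + 2) := by ring
      have hrest : (1 - (1 / 2 : ℝ) ^ (i + 2)) * weight p y (a.erase i) ≤
          p (Finsupp.linearCombination ℝ y (a.erase i)) := by
        refine ih (i + 1) (by omega) (a.erase i) fun j hj => ?_
        rw [Finsupp.support_erase, Finset.mem_erase] at hj
        have := ha j hj.2
        omega
      have hW := weight_nonneg (p := p) (x := y) (a.erase i)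
      by_cases hai : i ∈ a.support
      · have hw : weight p y a = |a i| * p (y i) + weight p y (a.erase i) :=
          (Finsupp.add_sum_erase a i (fun i t => |t| * p (y i)) hai).symm
        have hl : Finsupp.linearCombination ℝ y a =
            a i • y i + Finsupp.linearCombination ℝ y (a.erase i) := by
          conv_lhs => rw [← Finsupp.single_add_erase i a]
          rw [map_add, Finsupp.linearCombination_single]
        have hT : 0 ≤ |a i| * p (y i) := mul_nonneg (abs_nonneg _) (apply_nonneg p _)
        rw [hw, hl, hsplit]
        by_cases hr : a.erase i = 0
        · rw [hr, weight_zero, map_zero, add_zero, add_zero, map_smul_eq_mul, Real.norm_eq_abs]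
          nlinarith
        · have h2 := hpair i hi (a i) (a.erase i) (Finsupp.mem_support_iff.1 hai) hr fun j hj => by
            rw [Finsupp.support_erase, Finset.mem_erase] at hj
            have := ha j hj.2
            omega
          refine le_trans ?_ h2
          set s := (1 / 2 : ℝ) ^ (i + 2)
          calc (1 - (s + s)) * (|a i| * p (y i) + weight p y (a.erase i))
              ≤ (1 - s) * (|a i| * p (y i) + (1 - s) * weight p y (a.erase i)) := by
                nlinarith [mul_nonneg hp.1.le hT, mul_nonneg (mul_nonneg hp.1.le hp.1.le) hW]
            _ ≤ _ := mul_le_mul_of_nonneg_left (by linarith) (by linarith)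
      · have he : a.erase i = a := Finsupp.erase_of_notMem_support hai
        rw [he] at hrest hW
        refine le_trans (mul_le_mul_of_nonneg_right ?_ hW) hrest
        linarith
  -- Starting at index `1`, the estimate holds with `1 - 1/4`, more than the required `1/2`.
  refine ⟨fun j => y (1 + j), ?_, fun a => ?_⟩
  · refine IsBlockBasis.trans ?_ (isBlockBasis_tail y 1)
    exact isBlockBasis_comp x (φ := fun j => j + f j) fun i j hij => by
      have := hf hij.le
      simp only
      omega
  · have hinj : Function.Injective fun j => 1 + j := fun i j h => by simpa using h
    have h2 := key (a.support.sup id + 1) 1 le_rfl (a.mapDomain fun j => 1 + j) fun j hj => by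
      obtain ⟨k, hk, rfl⟩ := Finset.mem_image.1 (Finsupp.mapDomain_support hj)
      have : k ≤ a.support.sup id := Finset.le_sup (f := id) hk
      omega
    rw [Finsupp.linearCombination_mapDomain, weight,
      Finsupp.sum_mapDomain_index_inj hinj] at h2
    refine le_trans (mul_le_mul_of_nonneg_right ?_ (weight_nonneg a)) h2
    norm_num

end

section
variable {X : Type*} [NormedAddCommGroup X] [NormedSpace ℝ X]
variable {ℱ : Set (Finset ℕ)} {x y u : ℕ → X} {c : ℝ}

/-! ### Subspaces isomorphic to `ℓ₁` -/

theorem norm_ellOne_eq (f : lp (fun _ : ℕ => ℝ) 1) : HasSum (fun i => |f i|) ‖f‖ := by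
  simpa using lp.hasSum_norm (p := 1) (by simp) f

theorem EllOneEstimate.containsEllOne [CompleteSpace X] (hc : 0 < c)
    (hx : Nondegenerate (normSeminorm ℝ X) x) (h : EllOneEstimate (normSeminorm ℝ X) x c) :
    ContainsEllOne X := by
  have hpos : ∀ i, 0 < ‖x i‖ := hx.pos
  let v : ℕ → X := fun i => ‖x i‖⁻¹ • x i
  have hv : ∀ i (t : ℝ), ‖t • v i‖ = |t| := fun i t => by
    simp [v, norm_smul, (hpos i).ne']
  have hsum : ∀ f : lp (fun _ : ℕ => ℝ) 1, Summable fun i => f i • v i := fun f =>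
    .of_norm (by simpa only [hv] using (norm_ellOne_eq f).summable)
  let T : lp (fun _ : ℕ => ℝ) 1 →ₗ[ℝ] X :=
    { toFun := fun f => ∑' i, f i • v i
      map_add' := fun f g => by
        rw [← (hsum f).tsum_add (hsum g)]
        simp [add_smul]
      map_smul' := fun t f => by
        rw [RingHom.id_apply, ← (hsum f).tsum_const_smul]
        simp [mul_smul] }
  have hup : ∀ f, ‖T f‖ ≤ 1 * ‖f‖ := fun f => by
    rw [one_mul, ← (norm_ellOne_eq f).tsum_eq]
    refine (norm_tsum_le_tsum_norm ?_).trans_eq ?_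
    · simpa only [hv] using (norm_ellOne_eq f).summable
    · simp only [hv]
  have hlow : ∀ f, c * ‖f‖ ≤ ‖T f‖ := fun f => by
    refine le_of_tendsto_of_tendsto
      ((norm_ellOne_eq f).tendsto_sum_nat.const_mul c) (hsum f).hasSum.tendsto_sum_nat.norm
      (Eventually.of_forall fun n => ?_)
    -- An `ℓ₁` estimate gives a lower estimate for every family, so `univ` admits all initial
    -- segments.
    have h1 := (h.lowerEstimate (ℱ := univ) hc.le).sum_le hc.le
      (mem_univ (Finset.range n)) fun i => f i * ‖x i‖⁻¹
    have h2 : ∀ i, |f i * ‖x i‖⁻¹| * ‖x i‖ = |f i| := fun i => by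
      rw [abs_mul, abs_of_pos (inv_pos.2 (hpos i)), mul_assoc, inv_mul_cancel₀ (hpos i).ne', mul_one]
    simp only [coe_normSeminorm, h2, mul_smul] at h1
    exact h1
  have hinj : Function.Injective T := by
    refine (injective_iff_map_eq_zero T).2 fun f hf => ?_
    have h1 := hlow f
    rw [hf, norm_zero] at h1
    have h2 : ‖f‖ ≤ 0 := by
      by_contra! hcon
      have := mul_pos hc hcon
      linarith
    exact norm_le_zero_iff.1 h2
  refine ⟨LinearMap.range T, ⟨(LinearEquiv.ofInjective T hinj).toContinuousLinearEquivOfBounds 1 c⁻¹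
    hup fun w => ?_⟩⟩
  obtain ⟨f, rfl⟩ := (LinearEquiv.ofInjective T hinj).surjective w
  rw [LinearEquiv.symm_apply_apply, inv_mul_eq_div, le_div_iff₀ hc, mul_comm]
  exact hlow f

/-- The images of the unit vectors work; `K` bounds the inverse, and `C` enters because the weights
`‖u i‖` may be as large as `C`. -/
theorem ContainsEllOne.exists_ellOneEstimate (h : ContainsEllOne X) :
    ∃ u : ℕ → X, Nondegenerate (normSeminorm ℝ X) u ∧
      ∃ c, 0 < c ∧ EllOneEstimate (normSeminorm ℝ X) u c := by
  obtain ⟨Y, ⟨T⟩⟩ := h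
  let b : ℕ → lp (fun _ : ℕ => ℝ) 1 := fun i => lp.single 1 i 1
  let u : ℕ → X := fun i => (T (b i) : X)
  have hb : ∀ i, ‖b i‖ = 1 := fun i => by simp [b]
  have hbn : ∀ a : ℕ →₀ ℝ, ‖Finsupp.linearCombination ℝ b a‖ = a.sum fun _ t => |t| := by
    intro a
    have h1 := lp.norm_sum_single (E := fun _ : ℕ => ℝ) (p := 1) (by simp) (fun i => a i) a.support
    simp only [ENNReal.toReal_one, Real.rpow_one, Real.norm_eq_abs] at h1
    rw [Finsupp.sum, ← h1, Finsupp.linearCombination_apply, Finsupp.sum]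
    congr 1
    refine Finset.sum_congr rfl fun i _ => ?_
    rw [← lp.single_smul, _root_.smul_eq_mul, mul_one]
  have hu : ∀ a : ℕ →₀ ℝ, Finsupp.linearCombination ℝ u a =
      (T (Finsupp.linearCombination ℝ b a) : X) := fun a =>
    (Finsupp.apply_linearCombination ℝ
      (Y.subtype ∘ₗ (T.toLinearEquiv : lp (fun _ : ℕ => ℝ) 1 →ₗ[ℝ] Y)) b a).symm
  obtain ⟨C, hC, hTC⟩ := (T : lp (fun _ : ℕ => ℝ) 1 →L[ℝ] Y).bound
  obtain ⟨K, hK, hTK⟩ := (T.symm : Y →L[ℝ] lp (fun _ : ℕ => ℝ) 1).bound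
  have hlow : ∀ f, ‖f‖ ≤ K * ‖(T f : X)‖ := fun f => by simpa using hTK (T f)
  have hup : ∀ f, ‖(T f : X)‖ ≤ C * ‖f‖ := fun f => by simpa using hTC f
  refine ⟨u, fun a ha => ?_, 1 / (K * C), by positivity, fun a => ?_⟩
  · have h0 : Finsupp.linearCombination ℝ b a ≠ 0 := by
      rw [← norm_ne_zero_iff, hbn]
      refine (Finset.sum_pos (fun i hi => ?_) (Finsupp.support_nonempty_iff.2 ha)).ne'
      exact abs_pos.2 (Finsupp.mem_support_iff.1 hi)
    rw [hu, coe_normSeminorm, norm_pos_iff]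
    simpa using h0
  · have h1 : weight (normSeminorm ℝ X) u a ≤ C * a.sum fun _ t => |t| := by
      rw [Finsupp.mul_sum]
      refine Finset.sum_le_sum fun i _ => ?_
      have := hup (b i)
      rw [hb, mul_one] at this
      calc |a i| * ‖u i‖ ≤ |a i| * C := mul_le_mul_of_nonneg_left this (abs_nonneg _)
        _ = C * |a i| := mul_comm _ _
    have h2 := hlow (Finsupp.linearCombination ℝ b a)
    rw [hbn] at h2
    rw [hu, coe_normSeminorm, one_div, inv_mul_eq_div, div_le_iff₀ (by positivity)]
    calc weight (normSeminorm ℝ X) u a ≤ C * a.sum fun _ t => |t| := h1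
      _ ≤ C * (K * ‖(T (Finsupp.linearCombination ℝ b a) : X)‖) :=
          mul_le_mul_of_nonneg_left h2 hC.le
      _ = _ := by ring

/-- A dimension count: `n` coordinate functionals have a common zero among the nontrivial
combinations of `n + 1` vectors. -/
theorem exists_coord_eq_zero (e : SchauderBasis ℝ X) (hu : Nondegenerate (normSeminorm ℝ X) u)
    (N n : ℕ) : ∃ a : ℕ →₀ ℝ, weight (normSeminorm ℝ X) u a = 1 ∧ (∀ i ∈ a.support, N ≤ i) ∧
      ∀ k < n, e.coord k (Finsupp.linearCombination ℝ u a) = 0 := by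
  let G : (Fin (n + 1) → ℝ) →ₗ[ℝ] ℕ →₀ ℝ :=
    Fintype.linearCombination ℝ fun j : Fin (n + 1) => Finsupp.single (N + j : ℕ) (1 : ℝ)
  have hG : ∀ t, G t = ∑ j : Fin (n + 1), Finsupp.single (N + j : ℕ) (t j) := fun t => by
    simp [G, Fintype.linearCombination_apply]
  let Φ : (Fin (n + 1) → ℝ) →ₗ[ℝ] (Fin n → ℝ) :=
    LinearMap.pi fun k => (e.coord k : X →ₗ[ℝ] ℝ) ∘ₗ Finsupp.linearCombination ℝ u ∘ₗ G
  have hker : LinearMap.ker Φ ≠ ⊥ := LinearMap.ker_ne_bot_of_finrank_lt (by simp)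
  obtain ⟨t, ht, ht0⟩ := (Submodule.ne_bot_iff _).1 hker
  obtain ⟨j, hj⟩ := Function.ne_iff.1 ht0
  have hGt : G t ≠ 0 := by
    intro h0
    have h1 := DFunLike.congr_fun h0 (N + j : ℕ)
    rw [hG, Finsupp.finsetSum_apply, Finset.sum_eq_single j] at h1
    · simp only [Finsupp.single_eq_same, Finsupp.coe_zero, Pi.zero_apply] at h1
      exact hj h1
    · intro i _ hij
      refine Finsupp.single_eq_of_ne ?_
      intro h
      exact hij (Fin.ext (by omega))
    · simp
  have hW : 0 < weight (normSeminorm ℝ X) u (G t) := by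
    refine Finset.sum_pos (fun i hi => ?_) (Finsupp.support_nonempty_iff.2 hGt)
    exact mul_pos (abs_pos.2 (Finsupp.mem_support_iff.1 hi)) (hu.pos i)
  refine ⟨(weight (normSeminorm ℝ X) u (G t))⁻¹ • G t, ?_, fun i hi => ?_, fun k hk => ?_⟩
  · rw [weight_smul, abs_of_pos (inv_pos.2 hW), inv_mul_cancel₀ hW.ne']
  · have h1 := Finsupp.support_smul hi
    rw [hG] at h1
    obtain ⟨j, -, hj⟩ := Finset.mem_biUnion.1 (Finsupp.support_finsetSum h1)
    have := Finset.mem_singleton.1 (Finsupp.support_single_subset hj)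
    omega
  · have h1 : e.coord k (Finsupp.linearCombination ℝ u (G t)) = 0 :=
      congrFun (LinearMap.mem_ker.1 ht) ⟨k, hk⟩
    rw [map_smul, map_smul, h1, smul_zero]

/-- A gliding hump argument: a sequence equivalent to the unit vector basis of `ℓ₁` yields such a
block basis of a given basis. -/
theorem EllOneEstimate.exists_isBlockBasis (e : SchauderBasis ℝ X)
    (hu : Nondegenerate (normSeminorm ℝ X) u) (hc : 0 < c)
    (h : EllOneEstimate (normSeminorm ℝ X) u c) :
    ∃ y, IsBlockBasis e y ∧ EllOneEstimate (normSeminorm ℝ X) y (c / 4) := by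
  choose a ha1 ha2 ha3 using exists_coord_eq_zero e hu
  have hproj : ∀ N n, ∃ m ≥ n, ‖Finsupp.linearCombination ℝ u (a N n) -
      e.proj m (Finsupp.linearCombination ℝ u (a N n))‖ ≤ c / 2 := by
    intro N n
    have h1 := (e.tendsto_proj (Finsupp.linearCombination ℝ u (a N n))).const_sub
      (Finsupp.linearCombination ℝ u (a N n)) |>.norm
    rw [_root_.sub_self, norm_zero] at h1
    obtain ⟨m, hm, hmn⟩ := ((h1.eventually (ge_mem_nhds (half_pos hc))).and
      (eventually_ge_atTop n)).exists
    exact ⟨m, hmn, hm⟩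
  choose m hm1 hm2 using hproj
  -- The state records the first admissible index of `u` and the number of basis coordinates that
  -- must vanish.
  let s : ℕ → ℕ × ℕ := fun k =>
    Nat.rec (0, 0) (fun _ q => ((a q.1 q.2).support.sup id + 1, m q.1 q.2)) k
  let α : ℕ → ℕ →₀ ℝ := fun k => a (s k).1 (s k).2
  let v : ℕ → X := fun k => Finsupp.linearCombination ℝ u (α k)
  have hα0 : ∀ k, α k ≠ 0 := fun k h0 => by
    have := ha1 (s k).1 (s k).2
    rw [show a (s k).1 (s k).2 = 0 from h0, weight_zero] at this
    norm_num at this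
  have hα : IsBlock α := by
    refine isBlock_of_succ hα0 fun k i hi j hj => ?_
    have h1 : (α k).support.sup id + 1 ≤ j := ha2 _ _ j hj
    have h2 : i ≤ (α k).support.sup id := Finset.le_sup (f := id) hi
    omega
  have hvlow : ∀ k, c ≤ ‖v k‖ := fun k => by
    simpa [ha1, α, v] using h (α k)
  have hvup : ∀ k, ‖v k‖ ≤ 1 := fun k =>
    (seminorm_le_weight (p := normSeminorm ℝ X) (α k)).trans_eq (ha1 _ _)
  -- These are the coefficients of `v k` truncated where the next vector begins, so successive
  -- truncations have successive supports.
  let d : ℕ → ℕ →₀ ℝ := fun k => Finsupp.onFinset (Finset.range (s (k + 1)).2)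
    (fun i => if i < (s (k + 1)).2 then e.coord i (v k) else 0) fun i hi => by
      rw [Finset.mem_range]
      by_contra hcon
      simp [hcon] at hi
  let w : ℕ → X := fun k => Finsupp.linearCombination ℝ e (d k)
  have hw : ∀ k, w k = e.proj (s (k + 1)).2 (v k) := by
    intro k
    rw [SchauderBasis.proj_apply]
    simp only [w]
    rw [Finsupp.linearCombination_apply,
      Finsupp.sum_of_support_subset _ Finsupp.support_onFinset_subset _ (by simp)]
    refine Finset.sum_congr rfl fun i hi => ?_
    simp [Finset.mem_range.1 hi]
  have hvw : ∀ k, ‖v k - w k‖ ≤ c / 2 := fun k => by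
    rw [hw]
    exact hm2 _ _
  have hc1 : c ≤ 1 := (hvlow 0).trans (hvup 0)
  have hwup : ∀ k, ‖w k‖ ≤ 3 / 2 := fun k => by
    have h1 := norm_sub_norm_le (w k) (v k)
    rw [norm_sub_rev] at h1
    linarith [hvw k, hvup k]
  have hd : IsBlock d := by
    refine isBlock_of_succ (fun k h0 => ?_) fun k i hi j hj => ?_
    · have h1 : w k = 0 := by simp [w, h0]
      have h2 := hvw k
      rw [h1, _root_.sub_zero] at h2
      linarith [hvlow k]
    · have h1 : i < (s (k + 1)).2 := Finset.mem_range.1 (Finsupp.support_onFinset_subset hi)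
      have h2 : (s (k + 1)).2 ≤ j := by
        by_contra! hcon
        refine Finsupp.mem_support_iff.1 hj ?_
        simp only [d, Finsupp.onFinset_apply]
        split_ifs
        · exact ha3 _ _ j hcon
        · rfl
      omega
  refine ⟨w, ⟨d, hd, fun _ => rfl⟩, fun t => ?_⟩
  set S := t.sum fun _ r => |r| with hS
  have h1 : c * S ≤ ‖Finsupp.linearCombination ℝ v t‖ := by
    have h2 := h (Finsupp.linearCombination ℝ α t)
    rw [← linearCombination_comp, weight_linearCombination hα] at h2
    simpa [ha1, α, v, hS] using h2
  have h2 : ‖Finsupp.linearCombination ℝ v t - Finsupp.linearCombination ℝ w t‖ ≤ c / 2 * S := by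
    rw [Finsupp.linearCombination_apply, Finsupp.linearCombination_apply, Finsupp.sum, Finsupp.sum,
      ← Finset.sum_sub_distrib, hS, Finsupp.sum, Finset.mul_sum]
    refine (norm_sum_le _ _).trans (Finset.sum_le_sum fun i _ => ?_)
    rw [← smul_sub, norm_smul, Real.norm_eq_abs, mul_comm]
    exact mul_le_mul_of_nonneg_right (hvw i) (abs_nonneg _)
  have h3 : weight (normSeminorm ℝ X) w t ≤ 3 / 2 * S := by
    rw [hS, Finsupp.mul_sum]
    refine Finset.sum_le_sum fun i _ => ?_
    calc |t i| * ‖w i‖ ≤ |t i| * (3 / 2) := mul_le_mul_of_nonneg_left (hwup i) (abs_nonneg _)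
      _ = 3 / 2 * |t i| := mul_comm _ _
  have h4 := norm_sub_norm_le (Finsupp.linearCombination ℝ v t) (Finsupp.linearCombination ℝ w t)
  have hS0 : 0 ≤ S := Finset.sum_nonneg fun _ _ => abs_nonneg _
  rw [coe_normSeminorm]
  -- `cS - (c/2)S` dominates `(c/4)(3/2)S`.
  nlinarith

/-! ### Equivalent norms -/

theorem isEquivalentNorm_norm : IsEquivalentNorm (normSeminorm ℝ X) :=
  ⟨1, 1, one_pos, one_pos, fun v => by simp⟩

theorem IsEquivalentNorm.nondegenerate {p : Seminorm ℝ X} (hp : IsEquivalentNorm p)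
    (hx : LinearIndependent ℝ x) : Nondegenerate p x := by
  obtain ⟨a, b, ha, -, h⟩ := hp
  intro c hc
  have h0 : Finsupp.linearCombination ℝ x c ≠ 0 := fun h0 =>
    hc (linearIndependent_iff.1 hx c h0)
  exact (mul_pos ha (norm_pos_iff.2 h0)).trans_le (h _).1

theorem IsEquivalentNorm.comp_subtype {p : Seminorm ℝ X} (hp : IsEquivalentNorm p)
    (Y : Submodule ℝ X) : IsEquivalentNorm (p.comp Y.subtype) := by
  obtain ⟨a, b, ha, hb, h⟩ := hp
  exact ⟨a, b, ha, hb, fun v => h v⟩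

/-- An equivalent norm on a subspace extends to an equivalent norm on the whole space. -/
theorem IsEquivalentNorm.exists_extension {Y : Submodule ℝ X} {p : Seminorm ℝ Y}
    (hp : IsEquivalentNorm p) :
    ∃ q : Seminorm ℝ X, IsEquivalentNorm q ∧ q.comp Y.subtype = p := by
  obtain ⟨a, b, ha, hb, h⟩ := hp
  -- The infimal convolution of `p` and `b‖·‖`. It restricts to `p` on `Y` because `p ≤ b‖·‖` there.
  let f : X → ℝ := fun v => ⨅ w : Y, p w + b * ‖v - w‖
  have hbdd : ∀ v : X, BddBelow (range fun w : Y => p w + b * ‖v - w‖) := fun v =>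
    ⟨0, by rintro _ ⟨w, rfl⟩; positivity⟩
  have hle : ∀ (v : X) (w : Y), f v ≤ p w + b * ‖v - w‖ := fun v w => ciInf_le (hbdd v) w
  have hfub : ∀ v, f v ≤ b * ‖v‖ := fun v => by simpa using hle v 0
  have hadd : ∀ v v' : X, f (v + v') ≤ f v + f v' := by
    intro v v'
    refine le_ciInf_add_ciInf fun w w' => (hle _ (w + w')).trans ?_
    have h1 := map_add_le_add p w w'
    have h2 : ‖v + v' - ((w + w' : Y) : X)‖ ≤ ‖v - w‖ + ‖v' - w'‖ := by
      have : v + v' - ((w + w' : Y) : X) = (v - w) + (v' - w') := by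
        rw [Submodule.coe_add]
        abel
      rw [this]
      exact norm_add_le _ _
    nlinarith
  have hsmul : ∀ (r : ℝ) v, f (r • v) ≤ ‖r‖ * f v := by
    intro r v
    simp only [f]
    rw [Real.mul_iInf_of_nonneg (norm_nonneg r)]
    refine le_ciInf fun w => (hle _ (r • w)).trans_eq ?_
    rw [map_smul_eq_mul, Submodule.coe_smul, ← smul_sub, norm_smul]
    ring
  refine ⟨Seminorm.ofSMulLE f ?_ hadd hsmul, ⟨min a b, b, lt_min ha hb, hb, fun v =>
    ⟨le_ciInf fun w => ?_, hfub v⟩⟩, ?_⟩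
  · refine le_antisymm (by simpa using hfub 0) (le_ciInf fun w => ?_)
    positivity
  · have h1 : ‖v‖ ≤ ‖(w : X)‖ + ‖v - w‖ := by
      simpa using norm_add_le (w : X) (v - w)
    have h2 : a * ‖(w : X)‖ ≤ p w := (h w).1
    calc min a b * ‖v‖ ≤ min a b * (‖(w : X)‖ + ‖v - w‖) :=
          mul_le_mul_of_nonneg_left h1 (lt_min ha hb).le
      _ = min a b * ‖(w : X)‖ + min a b * ‖v - w‖ := mul_add _ _ _
      _ ≤ a * ‖(w : X)‖ + b * ‖v - w‖ := by
          gcongr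
          · exact min_le_left _ _
          · exact min_le_right _ _
      _ ≤ _ := by linarith
  · ext v
    refine le_antisymm ?_ (le_ciInf fun w => ?_)
    · exact (hle v v).trans_eq (by simp)
    · have h1 : p v ≤ p w + p (v - w) := by simpa using map_add_le_add p w (v - w)
      have h2 : p (v - w) ≤ b * ‖(v : X) - w‖ := (h (v - w)).2
      exact h1.trans (by simpa using h2)

theorem delta_comp {F : Type*} [NormedAddCommGroup F] [NormedSpace ℝ F] (f : F →ₗ[ℝ] X)
    (p : Seminorm ℝ X) (y : ℕ → F) : delta ℱ (p.comp f) y = delta ℱ p fun i => f (y i) := by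
  have h1 : ∀ c : ℕ →₀ ℝ, f (Finsupp.linearCombination ℝ y c) =
      Finsupp.linearCombination ℝ (fun i => f (y i)) c := fun c =>
    Finsupp.apply_linearCombination ℝ f y c
  simp only [delta, Seminorm.comp_apply, map_sum f, h1]

theorem IsBlockBasis.map {F : Type*} [NormedAddCommGroup F] [NormedSpace ℝ F] {x y : ℕ → F}
    (f : F →ₗ[ℝ] X) (h : IsBlockBasis x y) : IsBlockBasis (fun i => f (x i)) fun i => f (y i) := by
  obtain ⟨c, hc, rfl⟩ := isBlockBasis_iff.1 h
  exact ⟨c, hc, fun i => Finsupp.apply_linearCombination ℝ f x (c i)⟩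

theorem Stabilizes.toClosedSpan {A : LimitSequences} {p : Seminorm ℝ X}
    {γ : CountableOrdinal → ℝ} (h : Stabilizes A p x γ) :
    Stabilizes A (p.comp (closedSpan x).subtype) (toClosedSpan x) γ := by
  obtain ⟨ε, h1, h2, h3⟩ := h
  refine ⟨ε, h1, h2, fun α => ?_⟩
  obtain ⟨m, hm⟩ := h3 α
  refine ⟨m, fun n hn y hy => ?_⟩
  rw [delta_comp]
  exact hm n hn _ (hy.map (closedSpan x).subtype)

/-- The supremum formula for `δ̈_α`. -/
theorem isLUB_deltaDDot (e : SchauderBasis ℝ X) (A : LimitSequences) (α : CountableOrdinal) :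
    IsLUB {t : ℝ | ∃ γ ∈ spectrumDDot A e, t = γ α} (deltaDDot (schreier A α) e) := by
  have h0 := singleton_zero_mem_schreier (A := A) α.2
  have hnd : ∀ {p : Seminorm ℝ X}, IsEquivalentNorm p → Nondegenerate p e := fun hp =>
    hp.nondegenerate e.linearIndependent
  have hbdd : BddAbove {d : ℝ | ∃ p : Seminorm ℝ X, IsEquivalentNorm p ∧
      d = deltaDot (schreier A α) p e} := by
    refine ⟨1, ?_⟩
    rintro _ ⟨p, hp, rfl⟩
    exact deltaDot_le fun y hy => delta_le_one ((hnd hp).block hy) h0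
  constructor
  · rintro _ ⟨γ, ⟨x, hx, p, hp, hst⟩, rfl⟩
    obtain ⟨q, hq, rfl⟩ := hp.exists_extension
    refine hst.le_of_forall_delta_le fun N => ?_
    rw [delta_comp]
    exact (delta_le_deltaDot (hnd hq) h0 (hx.trans (isBlockBasis_tail x N))).trans
      (le_csSup hbdd ⟨q, hq, rfl⟩)
  · intro B hB
    refine csSup_le ⟨_, _, isEquivalentNorm_norm, rfl⟩ ?_
    rintro _ ⟨p, hp, rfl⟩
    -- A stabilizing block basis of `y` has all its tails among the block bases of `y`, so its `γ α`
    -- is at least `delta` of `y`.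
    refine deltaDot_le fun y hy => ?_
    have hyn := (hnd hp).block hy
    obtain ⟨x, hx, γ, hst⟩ := exists_stabilizes A hyn
    refine le_trans ?_ (hB ⟨γ, ⟨x, hy.trans hx, _, hp.comp_subtype _, hst.toClosedSpan⟩, rfl⟩)
    exact hst.le_of_forall_le_delta fun N => delta_le_of_isBlockBasis hyn h0
      (schreier_spreading α.2) (hx.trans (isBlockBasis_tail x N))

end

end DeltaSpectrum

/-! ### The proposition -/

theorem proposition4p8 {X : Type*} [NormedAddCommGroup X] [NormedSpace ℝ X] [CompleteSpace X]
    (e : SchauderBasis ℝ X) (A : DeltaSpectrum.LimitSequences) :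
    -- a)
    ((DeltaSpectrum.spectrum A e).Nonempty ∧
      ∀ γ ∈ DeltaSpectrum.spectrum A e, ∀ α, γ α ∈ Set.Icc (0 : ℝ) 1) ∧
    -- b)
    (DeltaSpectrum.ContainsEllOne X ↔
      ∃ γ ∈ DeltaSpectrum.spectrum A e, γ ⟨1, DeltaSpectrum.one_lt_omega_one⟩ = 1) ∧
    -- c)
    (∀ γ ∈ DeltaSpectrum.spectrum A e, ∀ α β, α ≤ β → γ β ≤ γ α) ∧
    -- d)
    (∀ γ ∈ DeltaSpectrum.spectrum A e, ∀ α β : DeltaSpectrum.CountableOrdinal,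
      γ α * γ β ≤ γ ⟨(β : Ordinal) + α, DeltaSpectrum.add_lt_omega_one β.2 α.2⟩) ∧
    -- e)
    (∀ γ ∈ DeltaSpectrum.spectrum A e, ∀ (α : DeltaSpectrum.CountableOrdinal) (n : ℕ), 1 ≤ n →
      γ α ^ n ≤ γ ⟨(α : Ordinal) * n, DeltaSpectrum.mul_nat_lt_omega_one α.2 n⟩) ∧
    -- f)
    (∀ γ ∈ DeltaSpectrum.spectrum A e, Continuous γ) ∧
    -- g)
    (∀ α : DeltaSpectrum.CountableOrdinal,
      IsLUB {t : ℝ | ∃ γ ∈ DeltaSpectrum.spectrumDDot A e, t = γ α}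
        (DeltaSpectrum.deltaDDot (DeltaSpectrum.schreier A α) e)) := by
  have he : DeltaSpectrum.Nondegenerate (normSeminorm ℝ X) e :=
    DeltaSpectrum.isEquivalentNorm_norm.nondegenerate e.linearIndependent
  refine ⟨⟨?_, ?_⟩, ⟨fun h => ?_, ?_⟩, ?_, ?_, ?_, ?_, DeltaSpectrum.isLUB_deltaDDot e A⟩
  · obtain ⟨x, hx, γ, hst⟩ := DeltaSpectrum.exists_stabilizes A he
    exact ⟨γ, x, hx, hst⟩
  · rintro γ ⟨x, hx, hst⟩
    exact hst.mem_Icc (he.block hx)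
  · obtain ⟨u, hu, c, hc, hest⟩ := h.exists_ellOneEstimate
    obtain ⟨y, hy, hesty⟩ := hest.exists_isBlockBasis e hu hc
    obtain ⟨z, hz, hst⟩ := hesty.exists_stabilizes (A := A) (he.block hy) (by positivity)
    exact ⟨_, ⟨z, hy.trans hz, hst⟩, rfl⟩
  · rintro ⟨γ, ⟨x, hx, hst⟩, h1⟩
    obtain ⟨y, hy, hest⟩ := hst.exists_ellOneEstimate h1
    exact hest.containsEllOne one_half_pos (he.block (hx.trans hy))
  · rintro γ ⟨x, hx, hst⟩ α β hαβ
    exact hst.antitone (he.block hx) hαβ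
  · rintro γ ⟨x, hx, hst⟩
    exact hst.mul_le (he.block hx)
  · rintro γ ⟨x, hx, hst⟩ α n hn
    exact hst.pow_le (he.block hx) α hn
  · rintro γ ⟨x, hx, hst⟩
    exact hst.continuous (he.block hx)
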